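/- **Setting.** Let $n,p\ge 1$ be integers, and write $[-a,b]^*=\{-a,\dots,-1,1,\dots,b\}$. Let $V(p,n)$ be the Fock space of order $p$ of $\mathfrak{osp}(2n+1|2n)$, i.e. of $n$ parafermions $c^\pm_{-n},\dots,c^\pm_{-1}$ and $n$ parabosons $c^\pm_1,\dots,c^\pm_n$ with relative parafermion relations, taken as the span of its orthonormal odd Gelfand–Zetlin basis, with the explicit action of the generators $c_i^\pm$ ($i\in[-n,n]^*$) on this basis, as follows. *Basis.* The basis vectors $|m)^{2n}$ of $V(p,n)$ are labelled by the arrays of integers $m_{i,r}\ge 0$, with rows $r=1,\dots,2n$ and, in row $r$, columns $i\in[-\lceil r/2\rceil,\lfloor r/2\rfloor]^*$, such that 1. $m_{-n,2n}\le p$, and $m_{j,2n}\ge m_{j+1,2n}$ for $-n\le j\le -2$ and for $1\le j\le n-1$; 2. $\theta_{-i,2s-1}:=m_{-i,2s}-m_{-i,2s-1}\in\{0,1\}$ for $1\le i\le s\le n$; 3. $\theta_{i,2s}:=m_{i,2s}-m_{i,2s+1}\in\{0,1\}$ for $1\le i\le s\le n-1$; 4. $m_{-1,2s}\ge\#\{i\in[1,s]: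 m_{i,2s}>0\}$ for $1\le s\le n$; 5. $m_{-1,2s+1}\ge\#\{i\in[1,s]: m_{i,2s}>0\}$ for $1\le s\le n-1$; 6. $m_{i,2s}\ge m_{i,2s-1}\ge m_{i+1,2s}$ for $1\le i\le s-1\le n-1$; 7. $m_{-i-1,2s+1}\ge m_{-i,2s}\ge m_{-i,2s+1}$ for $1\le i\le s\le n-1$. Row $r$ is written $[m]^r=[\dots,m_{-2,r},m_{-1,r};m_{1,r},m_{2,r},\dots]$. The pattern has *zero second part* if $m_{i,2n}=0$ for all $i\in[1,n]$. It is *row-stable with respect to row $s$* if there is a partition $\nu$ such that each of the rows $s,s+1,\dots,2n$ is of the form $[\nu_1,\nu_2,\dots,0;0,0,\dots]$ (the last entry of the left part being $0$). *Action.* Put $\rho(i)=2i$ for $i>0$ and $\rho(i)=-2i-1$ for $i<0$. Then $c_i^\pm|m)^{2n}=\sum_{m'}C^\pm[i,|m)^{2n},|m')^{2n}]\,|m')^{2n}$, the sum being over the basis, where $C^-[i,|m),|m')]=C^+[i,|m'),|m)]$ and $C^+[i,|m),|m')]=0$ unless rows $1,\dots,\rho(i)-1$ of $m$ and $m'$ coincide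 and, for each $r\in[\rho(i),2n]$, row $r$ of $m'$ is obtained from row $r$ of $m$ by adding $1$ to one entry, in column $k_r$ say. In that case, with $j=\rho(i)$, $$C^+[i,|m),|m')]=\sigma_j\; I^0_j(k_j)\Big(\prod_{r=j+1}^{2n} I^1_r(k_r,k_{r-1})\Big)\; G_n([m]^{2n};k_{2n}),$$ where $\sigma_j=1$ for $j$ odd, and $\sigma_j=(-1)^{\sum_{s=1}^{t}\sum_{h=-s}^{-1}\theta_{h,2s-1}+\sum_{s=1}^{t-1}\sum_{h=1}^{s}\theta_{h,2s}}$ for $j=2t$ even. The $\mathfrak{gl}$ isoscalar factors $I^0_r,I^1_r$ and the reduced matrix elements $G_n$ are given below. Every quotient is read as follows: if its numerator has more vanishing factors than its denominator, it is $0$; otherwise vanishing factors of the numerator are cancelled against vanishing factors of the denominator. All $m$'s and $\theta$'s are those of the unprimed pattern. *Isoscalar factors.* For $r\in\{2t,2t-1\}$ let $a_i=m_{i,r}-i$ ($i<0$), $a_i=-m_{i,r}+i$ ($i>0$), and let $b_i$ be the same expressions for row $r-1$. Let $\delta=\delta_{kq}$, and $S(k,q)=1$ if $k\le q$, $S(k,q)=-1$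 if $k>q$. Products over $i$ are over negative indices, products over $s$ over positive indices. For $r=2t$ put $\theta_i=\theta_{i,2t-1}$. Then $I^0_r(k)=(-1)^{t+k}(1-\theta_k)(-1)^{\sum_{i=k}^{-1}\theta_i}\Big(\prod_{i=-t,\,i\ne k}^{-1}\frac{a_k-a_i+1}{a_k-b_i}\cdot\frac{\prod_{s=1}^{t-1}(a_k-b_s)}{\prod_{s=1}^{t}(a_k-a_s+1)}\Big)^{1/2}$ for $k<0$; $I^0_r(k)=\Big(\prod_{i=-t}^{-1}\frac{a_i-a_k}{b_i-a_k+1}\cdot\frac{\prod_{s=1}^{t-1}(b_s-a_k+1)}{\prod_{s=1,\,s\ne k}^{t}(a_s-a_k)}\Big)^{1/2}$ for $k>0$; $I^1_r(k,q)=(-1)^{k+q}(-1)^{\sum_{i=\min(k,q)+1}^{\max(k,q)-1}\theta_i}\,\frac{\delta+(1-\delta)\theta_q(1-\theta_k)}{(a_k-a_q)^{1-\delta}}\Big(\prod_{i=-t,\,i\ne k,q}^{-1}\frac{(b_i-b_k-1-\delta+2\theta_i)(b_i-b_q)}{(a_i-a_k)(a_i-a_q)}\prod_{s=1}^{t}\frac{a_q-a_s}{a_k-a_s+1}\prod_{s=1}^{t-1}\frac{a_k-b_s}{b_q-b_s}\Big)^{\theta_q/2}$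 for $k,q<0$; $I^1_r(k,q)=(-1)^{k+t+1}(-1)^{\sum_{i=-t}^{k-1}\theta_i}(1-\theta_k)\Big(\frac1{a_k-b_q}\prod_{i=-t,\,i\ne k}^{-1}\frac{(b_i-b_k-1+2\theta_i)(b_i-b_q+1)}{(a_i-a_k)(a_i-b_q)}\prod_{s=1}^{t}\frac{|a_s-b_q|}{a_k-a_s+1}\prod_{s=1,\,s\ne q}^{t-1}\frac{a_k-b_s}{|b_s-b_q+1|}\Big)^{1/2}$ for $k<0<q$; $I^1_r(k,q)=(-1)^{q+t+1}(-1)^{\sum_{i=q+1}^{-1}\theta_i}\theta_q\Big(\frac1{a_q-a_k+1}\prod_{i=-t}^{-1}\frac{a_i-a_k}{b_i-a_k+1}\prod_{i=-t,\,i\ne q}^{-1}\frac{|b_q-b_i|}{|a_q-a_i|}\prod_{s=1,\,s\ne k}^{t}\frac{|a_q-a_s|}{|a_s-a_k|}\prod_{s=1}^{t-1}\frac{|b_s-a_k+1|}{|a_q-b_s-1|}\Big)^{1/2}$ for $q<0<k$; $I^1_r(k,q)=S(k,q)(-1)^{\sum_{i=-t}^{-1}\theta_i}\Big(\prod_{i=-t}^{-1}\frac{(a_i-a_k)(b_i-b_q+1)}{(b_i-a_k+1)(a_i-b_q)}\prod_{s=1,\,s\ne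 k}^{t}\frac{|a_s-b_q|}{|a_s-a_k|}\prod_{s=1,\,s\ne q}^{t-1}\frac{|b_s-a_k+1|}{|b_s-b_q+1|}\Big)^{1/2}$ for $k,q>0$. For $r=2t-1$ put $\theta_i=\theta_{i,2t-2}$. Then $I^0_r(k)=(-1)^{t+k}\Big(\frac{\prod_{i=-t+1}^{-1}(a_k-b_i)}{\prod_{i=-t,\,i\ne k}^{-1}(a_k-a_i)}\prod_{s=1}^{t-1}\frac{a_k-a_s}{a_k-b_s}\Big)^{1/2}$ for $k<0$; $I^0_r(k)=\theta_k(-1)^{k}(-1)^{\sum_{s=k+1}^{t-1}\theta_s}\Big(\frac{\prod_{i=-t+1}^{-1}(b_i-a_k+1)}{\prod_{i=-t}^{-1}(a_i-a_k+1)}\prod_{s=1,\,s\ne k}^{t-1}\frac{a_s-a_k+1}{b_s-a_k+1}\Big)^{1/2}$ for $k>0$; $I^1_r(k,q)=(-1)^{k+q}S(-k,-q)\Big(\prod_{i=-t,\,i\ne k}^{-1}\frac{b_q-a_i+1}{a_k-a_i}\prod_{i=-t+1,\,i\ne q}^{-1}\frac{a_k-b_i}{b_q-b_i+1}\prod_{s=1}^{t-1}\frac{(a_k-a_s)(b_q-b_s+1)}{(a_k-b_s)(b_q-a_s+1)}\Big)^{1/2}$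 for $k,q<0$; $I^1_r(k,q)=(-1)^{k+t}(-1)^{\sum_{s=1}^{q-1}\theta_s}(1-\theta_q)\Big(\frac{1}{a_k-b_q+1}\prod_{i=-t,\,i\ne k}^{-1}\frac{a_i-b_q}{a_k-a_i}\prod_{i=-t+1}^{-1}\frac{a_k-b_i}{b_i-b_q}\prod_{s=1,\,s\ne q}^{t-1}\frac{(a_k-a_s)(b_s-b_q)}{(a_k-b_s)(a_s-b_q)}\Big)^{1/2}$ for $k<0<q$; $I^1_r(k,q)=(-1)^{k+q+t}(-1)^{\sum_{s=k+1}^{t-1}\theta_s}\theta_k\Big(\frac1{b_q-a_k+1}\prod_{i=-t}^{-1}\frac{|a_i-b_q-1|}{a_i-a_k+1}\prod_{i=-t+1,\,i\ne q}^{-1}\frac{b_i-a_k+1}{|b_i-b_q-1|}\prod_{s=1,\,s\ne k}^{t-1}\frac{(b_q-b_s+1)(a_s-a_k+1)}{(b_q-a_s+1)(b_s-a_k+1)}\Big)^{1/2}$ for $q<0<k$; $I^1_r(k,q)=(-1)^{k-1}(-1)^{\sum_{s=1}^{t-1}\theta_s}\,\frac{\delta+(1-\delta)\theta_k(1-\theta_q)}{(a_k-a_q)^{1-\delta}}\Big(\prod_{i=-t}^{-1}\frac{a_i-b_q}{a_i-a_k+1}\prod_{i=-t+1}^{-1}\frac{b_i-a_k+1}{b_i-b_q}\prod_{s=1,\,s\ne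 k,q}^{t-1}\frac{(b_s-b_q+1-\delta+2\theta_s)(b_s-b_q)}{(a_s-a_k)(a_s-b_q)}\Big)^{(1-\theta_q)/2}$ for $k,q>0$. *Reduced matrix elements.* Write $\mathcal E_x=1$, $\mathcal O_x=0$ for $x$ even and $\mathcal E_x=0$, $\mathcal O_x=1$ for $x$ odd; $A_j=m_{j-n-1,2n}$ and $B_j=m_{j,2n}$ for $1\le j\le n$. For $k<0$ put $\kappa=n+k+1$. Then $G_n=\Big(-(\mathcal E_n(A_\kappa-\kappa)+1)\frac{\prod_{j\ne\kappa}(A_\kappa-A_j-\kappa+j)}{\prod_{j\ne\kappa,\,j\text{ even}}(A_\kappa-A_j-\kappa+j)(A_\kappa-A_j-\kappa+j+1)}\prod_{j=1}^n\frac{A_\kappa+B_j+n-j-\kappa+2}{A_\kappa+B_j+n-j-\kappa+2-\mathcal E_{n+B_j}}\Big)^{1/2}$ for $k<0$, $\kappa$ even; $G_n=\Big((p-A_\kappa+\kappa-1)(\mathcal O_n(A_\kappa-\kappa)+1)\frac{\prod_{j\ne\kappa}(A_\kappa-A_j-\kappa+j)}{\prod_{j\ne\kappa,\,j\text{ odd}}(A_\kappa-A_j-\kappa+j)(A_\kappa-A_j-\kappa+j+1)}\prod_{j=1}^n\frac{A_\kappa+B_j+n-j-\kappa+2}{A_\kappa+B_j+n-j-\kappa+2-\mathcal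 O_{n+B_j}}\Big)^{1/2}$ for $k<0$, $\kappa$ odd; $G_n=(-1)^{\sum_{j=k+1}^nB_j}\Big((\mathcal O_{B_k}(B_k+n-k)+1)(\mathcal E_{n+B_k}(p+B_k+n-k)+1)\prod_{j\ne k}\frac{B_j-B_k-j+k}{B_j-B_k-j+k-\mathcal O_{B_j-B_k}}\cdot\frac{\prod_{j:\,n+B_k+j\text{ even}}(A_j+B_k+n-j-k+2)}{\prod_{j:\,n+B_k+j\text{ odd}}(A_j+B_k+n-j-k+1)}\Big)^{1/2}$ for $k>0$ (all $j$ in $\{1,\dots,n\}$). *The map $\phi_{2n,+2}$.* If $|m)^{2n}$ has zero second part, with top row $[\nu_1,\dots,\nu_n;0,\dots,0]$, then $\phi_{2n,+2}(|m)^{2n})=|m)^{2n+2}$ is the basis vector of $V(p,n+1)$ whose rows $1,\dots,2n$ are those of $|m)^{2n}$ and whose rows $2n+1$ and $2n+2$ are $[\nu_1,\dots,\nu_n,0;0,\dots,0]$ (with $n$, respectively $n+1$, zeros in the right part). It is extended linearly to the span of the basis vectors with zero second part. **Proposition.** Let $|m)^{2n}$ be a basis vector of $V(p,n)$ that is row-stable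 with respect to row $2n$, and let $|m)^{2n+2}=\phi_{2n,+2}(|m)^{2n})$. Then for every $i\in[-n,n]^*$ and for both signs, $c_i^\pm|m)^{2n}$ is a linear combination of basis vectors with zero second part, and $$c_i^{\pm}\,|m)^{2n+2}=\phi_{2n,+2}\big(c_i^{\pm}\,|m)^{2n}\big),$$ where the left-hand side is computed in $V(p,n+1)$ and the right-hand side in $V(p,n)$. Moreover, for all $|m')^{2n}$ with zero second part and $|m')^{2n+2}=\phi_{2n,+2}(|m')^{2n})$, $$C^\pm\big[i,|m)^{2n+2},|m')^{2n+2}\big]=C^\pm\big[i,|m)^{2n},|m')^{2n}\big].$$ -/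

import Mathlib

open Finset

noncomputable section

namespace OddGZ

/-! ### Columns, patterns -/

/-- Columns `-⌈r/2⌉, …, -1` of the left part of row `r`. -/
def leftCols (r : ℕ) : Finset ℤ := Icc (-(((r + 1) / 2 : ℕ) : ℤ)) (-1)

/-- Columns `1, …, ⌊r/2⌋` of the right part of row `r`. -/
def rightCols (r : ℕ) : Finset ℤ := Icc 1 ((r / 2 : ℕ) : ℤ)

/-- All columns of row `r`. -/
def cols (r : ℕ) : Finset ℤ := leftCols r ∪ rightCols r

/-- The patterns `|p; m)^{2n}` labelling the basis vectors of the Fock space `V(p,n)`: triangular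
arrays of nonnegative integers with rows `1, …, 2n` (counted from the bottom) in the odd
Gelfand-Zetlin scheme. `entry r i` is the label `m_{i,r}`; it is set to `0` off the triangle.
The two fields `count_even` and `count_odd` say that every row is a highest weight of a covariant
module, and that the steps `gl(s+1|s) ⊃ gl(s|s)` obey the branching rule: as the entries of the right
part do not increase from row `2s` to row `2s+1`, `count_odd` also gives
`m_{-1,2s+1} ≥ #{i : m_{i,2s+1} > 0}`. -/
@[ext]
structure GZPattern (n p : ℕ) where
  entry : ℕ → ℤ → ℕ
  entry_eq_zero : ∀ r i, ¬ (1 ≤ r ∧ r ≤ 2 * n ∧ i ∈ cols r) → entry r i = 0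
  le_order : entry (2 * n) (-(n : ℤ)) ≤ p
  top_left : ∀ j : ℤ, -(n : ℤ) ≤ j → j ≤ -2 → entry (2 * n) (j + 1) ≤ entry (2 * n) j
  top_right : ∀ j : ℤ, 1 ≤ j → j ≤ n - 1 → entry (2 * n) (j + 1) ≤ entry (2 * n) j
  theta_left : ∀ s : ℕ, 1 ≤ s → s ≤ n → ∀ i : ℤ, 1 ≤ i → i ≤ s →
    entry (2 * s) (-i) = entry (2 * s - 1) (-i) ∨ entry (2 * s) (-i) = entry (2 * s - 1) (-i) + 1
  theta_right : ∀ s : ℕ, 1 ≤ s → s + 1 ≤ n → ∀ i : ℤ, 1 ≤ i → i ≤ s →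
    entry (2 * s) i = entry (2 * s + 1) i ∨ entry (2 * s) i = entry (2 * s + 1) i + 1
  count_even : ∀ s : ℕ, 1 ≤ s → s ≤ n →
    #{i ∈ rightCols (2 * s) | 0 < entry (2 * s) i} ≤ entry (2 * s) (-1)
  count_odd : ∀ s : ℕ, 1 ≤ s → s + 1 ≤ n →
    #{i ∈ rightCols (2 * s) | 0 < entry (2 * s) i} ≤ entry (2 * s + 1) (-1)
  between_right : ∀ s : ℕ, 1 ≤ s → s ≤ n → ∀ i : ℤ, 1 ≤ i → i ≤ s - 1 →
    entry (2 * s - 1) i ≤ entry (2 * s) i ∧ entry (2 * s) (i + 1) ≤ entry (2 * s - 1) i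
  between_left : ∀ s : ℕ, 1 ≤ s → s + 1 ≤ n → ∀ i : ℤ, 1 ≤ i → i ≤ s →
    entry (2 * s) (-i) ≤ entry (2 * s + 1) (-i - 1) ∧ entry (2 * s + 1) (-i) ≤ entry (2 * s) (-i)

/-- Row-stability with respect to row `s`: there is a partition `ν` such that each of the rows
`s, s+1, …, 2n` is of the form `[ν₁, ν₂, …, 0; 0, 0, …]`. -/
def GZPattern.RowStable {n p : ℕ} (m : GZPattern n p) (s : ℕ) : Prop :=
  ∃ ν : ℕ → ℕ, Antitone ν ∧ ∀ r : ℕ, s ≤ r → r ≤ 2 * n →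
    (∀ j : ℕ, j < (r + 1) / 2 → m.entry r (-(((r + 1) / 2 : ℕ) : ℤ) + j) = ν j) ∧
    m.entry r (-1) = 0 ∧ ∀ i ∈ rightCols r, m.entry r i = 0

/-- The right part of the top row consists of zeros. -/
def GZPattern.RightZero {n p : ℕ} (m : GZPattern n p) : Prop :=
  ∀ i ∈ rightCols (2 * n), m.entry (2 * n) i = 0

/-! ### Isoscalar factors

`u` and `d` are two consecutive rows of a pattern, `u` lying directly above `d`. -/

/-- The labels `l_{i,r}`: `m_{i,r} - i` in the left part, `-m_{i,r} + i` in the right part. -/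
def lab (u : ℤ → ℕ) (i : ℤ) : ℝ := if i < 0 then (u i : ℝ) - i else -(u i : ℝ) + i

/-- The sign `(-1)^z`. -/
def sgn (z : ℤ) : ℝ := (-1) ^ z

/-- The sign `S(k,q)`. -/
def sgnS (k q : ℤ) : ℝ := if k ≤ q then 1 else -1

/-- The quotient of the product of the factors `num` by the product of the factors `den`, where
vanishing factors of the numerator are cancelled against vanishing factors of the denominator. -/
def quot (num den : Multiset ℝ) : ℝ :=
  if den.count 0 < num.count 0 then 0
  else (num.filter (fun x => x ≠ 0)).prod / (den.filter (fun x => x ≠ 0)).prod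

/-- The family of factors `f i`, `i ∈ s`. -/
def factors (s : Finset ℤ) (f : ℤ → ℝ) : Multiset ℝ := s.val.map f

/-- `gl(t|t) ⊃ gl(t|t-1)`, lower row unchanged, upper row raised in column `k`. -/
def isoEven0 (t : ℤ) (u d : ℤ → ℕ) (k : ℤ) : ℝ :=
  let a : ℤ → ℝ := lab u
  let b : ℤ → ℝ := lab d
  let θ : ℤ → ℤ := fun i => (u i : ℤ) - d i
  let N : Finset ℤ := Icc (-t) (-1)
  let P : Finset ℤ := Icc 1 t
  let P' : Finset ℤ := Icc 1 (t - 1)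
  if k < 0 then
    sgn (t + k) * (1 - θ k) * sgn (∑ i ∈ Icc k (-1), θ i) *
      Real.sqrt (quot
        (factors (N.erase k) (fun i => a k - a i + 1) + factors P' (fun s => a k - b s))
        (factors (N.erase k) (fun i => a k - b i) + factors P (fun s => a k - a s + 1)))
  else
    Real.sqrt (quot
      (factors N (fun i => a i - a k) + factors P' (fun s => b s - a k + 1))
      (factors N (fun i => b i - a k + 1) + factors (P.erase k) (fun s => a s - a k)))

/-- `gl(t|t) ⊃ gl(t|t-1)`, upper row raised in column `k`, lower row raised in column `q`. -/
def isoEven1 (t : ℤ) (u d : ℤ → ℕ) (k q : ℤ) : ℝ :=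
  let a : ℤ → ℝ := lab u
  let b : ℤ → ℝ := lab d
  let θ : ℤ → ℤ := fun i => (u i : ℤ) - d i
  let δ : ℝ := if k = q then 1 else 0
  let N : Finset ℤ := Icc (-t) (-1)
  let P : Finset ℤ := Icc 1 t
  let P' : Finset ℤ := Icc 1 (t - 1)
  if k < 0 then
    if q < 0 then
      sgn (k + q) * sgn (∑ i ∈ Icc (min (k + 1) (q + 1)) (max (k - 1) (q - 1)), θ i) *
        (δ + (1 - δ) * θ q * (1 - θ k)) *
        (Real.sqrt (quot
          (factors ((N.erase k).erase q) (fun i => b i - b k - 1 - δ + 2 * θ i) +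
            factors ((N.erase k).erase q) (fun i => b i - b q) +
            factors P (fun s => a q - a s) + factors P' (fun s => a k - b s))
          (factors ((N.erase k).erase q) (fun i => a i - a k) +
            factors ((N.erase k).erase q) (fun i => a i - a q) +
            factors P (fun s => a k - a s + 1) + factors P' (fun s => b q - b s)))) ^ (θ q) *
        (if k = q then 1 else 1 / (a k - a q))
    else
      sgn (k + t + 1) * sgn (∑ i ∈ Icc (-t) (k - 1), θ i) * (1 - θ k) *
        Real.sqrt (quot
          (factors (N.erase k) (fun i => b i - b k - 1 + 2 * θ i) +
            factors (N.erase k) (fun i => b i - b q + 1) +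
            factors P (fun s => |a s - b q|) + factors (P'.erase q) (fun s => a k - b s))
          (factors {q} (fun _ => a k - b q) +
            factors (N.erase k) (fun i => a i - a k) + factors (N.erase k) (fun i => a i - b q) +
            factors P (fun s => a k - a s + 1) + factors (P'.erase q) (fun s => |b s - b q + 1|)))
  else
    if q < 0 then
      sgn (q + t + 1) * sgn (∑ i ∈ Icc (q + 1) (-1), θ i) * θ q *
        Real.sqrt (quot
          (factors N (fun i => a i - a k) + factors (N.erase q) (fun i => |b q - b i|) +
            factors (P.erase k) (fun s => |a q - a s|) + factors P' (fun s => |b s - a k + 1|))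
          (factors {q} (fun _ => a q - a k + 1) +
            factors N (fun i => b i - a k + 1) + factors (N.erase q) (fun i => |a q - a i|) +
            factors (P.erase k) (fun s => |a s - a k|) + factors P' (fun s => |a q - b s - 1|)))
    else
      sgnS k q * sgn (∑ i ∈ N, θ i) *
        Real.sqrt (quot
          (factors N (fun i => a i - a k) + factors N (fun i => b i - b q + 1) +
            factors (P.erase k) (fun s => |a s - b q|) +
            factors (P'.erase q) (fun s => |b s - a k + 1|))
          (factors N (fun i => b i - a k + 1) + factors N (fun i => a i - b q) +
            factors (P.erase k) (fun s => |a s - a k|) +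
            factors (P'.erase q) (fun s => |b s - b q + 1|)))

/-- `gl(t|t-1) ⊃ gl(t-1|t-1)`, lower row unchanged, upper row raised in column `k`. -/
def isoOdd0 (t : ℤ) (u d : ℤ → ℕ) (k : ℤ) : ℝ :=
  let a : ℤ → ℝ := lab u
  let b : ℤ → ℝ := lab d
  let θ : ℤ → ℤ := fun i => (d i : ℤ) - u i
  let N : Finset ℤ := Icc (-t) (-1)
  let N' : Finset ℤ := Icc (-t + 1) (-1)
  let P : Finset ℤ := Icc 1 (t - 1)
  if k < 0 then
    sgn (t + k) *
      Real.sqrt (quot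
        (factors N' (fun s => a k - b s) + factors P (fun i => a k - a i))
        (factors (N.erase k) (fun s => a k - a s) + factors P (fun i => a k - b i)))
  else
    θ k * sgn k * sgn (∑ i ∈ Icc (k + 1) (t - 1), θ i) *
      Real.sqrt (quot
        (factors N' (fun s => b s - a k + 1) + factors (P.erase k) (fun i => a i - a k + 1))
        (factors N (fun s => a s - a k + 1) + factors (P.erase k) (fun i => b i - a k + 1)))

/-- `gl(t|t-1) ⊃ gl(t-1|t-1)`, upper row raised in column `k`, lower row raised in column `q`. -/
def isoOdd1 (t : ℤ) (u d : ℤ → ℕ) (k q : ℤ) : ℝ :=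
  let a : ℤ → ℝ := lab u
  let b : ℤ → ℝ := lab d
  let θ : ℤ → ℤ := fun i => (d i : ℤ) - u i
  let δ : ℝ := if k = q then 1 else 0
  let N : Finset ℤ := Icc (-t) (-1)
  let N' : Finset ℤ := Icc (-t + 1) (-1)
  let P : Finset ℤ := Icc 1 (t - 1)
  if k < 0 then
    if q < 0 then
      sgn (k + q) * sgnS (-k) (-q) *
        Real.sqrt (quot
          (factors (N.erase k) (fun i => b q - a i + 1) +
            factors (N'.erase q) (fun i => a k - b i) +
            factors P (fun s => a k - a s) + factors P (fun s => b q - b s + 1))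
          (factors (N.erase k) (fun i => a k - a i) +
            factors (N'.erase q) (fun i => b q - b i + 1) +
            factors P (fun s => a k - b s) + factors P (fun s => b q - a s + 1)))
    else
      sgn (k + t) * sgn (∑ i ∈ Icc 1 (q - 1), θ i) * (1 - θ q) *
        Real.sqrt (quot
          (factors (N.erase k) (fun i => a i - b q) + factors N' (fun i => a k - b i) +
            factors (P.erase q) (fun s => a k - a s) + factors (P.erase q) (fun s => b s - b q))
          (factors {q} (fun _ => a k - b q + 1) +
            factors (N.erase k) (fun i => a k - a i) + factors N' (fun i => b i - b q) +
            factors (P.erase q) (fun s => a k - b s) + factors (P.erase q) (fun s => a s - b q)))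
  else
    if q < 0 then
      sgn (k + q + t) * sgn (∑ i ∈ Icc (k + 1) (t - 1), θ i) * θ k *
        Real.sqrt (quot
          (factors N (fun i => |a i - b q - 1|) + factors (N'.erase q) (fun i => b i - a k + 1) +
            factors (P.erase k) (fun s => b q - b s + 1) +
            factors (P.erase k) (fun s => a s - a k + 1))
          (factors {q} (fun _ => b q - a k + 1) +
            factors N (fun i => a i - a k + 1) + factors (N'.erase q) (fun i => |b i - b q - 1|) +
            factors (P.erase k) (fun s => b q - a s + 1) +
            factors (P.erase k) (fun s => b s - a k + 1)))
    else
      sgn (k - 1) * sgn (∑ i ∈ P, θ i) * (δ + (1 - δ) * θ k * (1 - θ q)) *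
        (if k = q then 1 else 1 / (a k - a q)) *
        (Real.sqrt (quot
          (factors N (fun i => a i - b q) + factors N' (fun i => b i - a k + 1) +
            factors ((P.erase k).erase q) (fun s => b s - b q + 1 - δ + 2 * θ s) +
            factors ((P.erase k).erase q) (fun s => b s - b q))
          (factors N (fun i => a i - a k + 1) + factors N' (fun i => b i - b q) +
            factors ((P.erase k).erase q) (fun s => a s - a k) +
            factors ((P.erase k).erase q) (fun s => a s - b q)))) ^ (1 - θ q)

/-! ### Clebsch-Gordan coefficients

`m` and `m'` are arrays of entries, `m r i` being the label in row `r` and column `i`. -/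

/-- Row `r` of `m'` is row `r` of `m` with the label in column `k` raised by one. -/
abbrev Raised (m m' : ℕ → ℤ → ℕ) (r : ℕ) (k : ℤ) : Prop :=
  ∀ i ∈ cols r, m' r i = m r i + if i = k then 1 else 0

/-- The isoscalar factor of rows `r`, `r-1` with upper row `10⋯0` and lower row `0⋯0` in the
pattern of the standard representation. -/
def iso0 (m m' : ℕ → ℤ → ℕ) (r : ℕ) : ℝ :=
  ∑ k ∈ cols r, if Raised m m' r k then
    (if Even r then isoEven0 ((r / 2 : ℕ) : ℤ) (m r) (m (r - 1)) k
      else isoOdd0 (((r + 1) / 2 : ℕ) : ℤ) (m r) (m (r - 1)) k) else 0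

/-- The isoscalar factor of rows `r`, `r-1` with both rows equal to `10⋯0` in the pattern of the
standard representation. -/
def iso1 (m m' : ℕ → ℤ → ℕ) (r : ℕ) : ℝ :=
  ∑ k ∈ cols r, ∑ q ∈ cols (r - 1), if Raised m m' r k ∧ Raised m m' (r - 1) q then
    (if Even r then isoEven1 ((r / 2 : ℕ) : ℤ) (m r) (m (r - 1)) k q
      else isoOdd1 (((r + 1) / 2 : ℕ) : ℤ) (m r) (m (r - 1)) k q) else 0

/-- The sum of all `θ`'s occurring in rows `1, …, 2t`. -/
def thetaSum (m : ℕ → ℤ → ℕ) (t : ℕ) : ℤ :=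
  ∑ s ∈ Icc 1 t, ∑ i ∈ leftCols (2 * s), ((m (2 * s) i : ℤ) - m (2 * s - 1) i) +
    ∑ s ∈ Icc 1 (t - 1), ∑ i ∈ rightCols (2 * s), ((m (2 * s) i : ℤ) - m (2 * s + 1) i)

/-- `cgc m m' j R` is the Clebsch-Gordan coefficient `(|1_j); m | m')` for patterns with `R` rows,
where `|1_j)` has zero rows `1, …, j-1` and rows `10⋯0` from row `j` on: an isoscalar factor
times the coefficient for the patterns with the top row removed. The even vectors among the `|1_j)`
are those with `j` odd; the odd ones produce a sign. -/
def cgc (m m' : ℕ → ℤ → ℕ) (j : ℕ) : ℕ → ℝ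
  | 0 => 0
  | R + 1 =>
    if j = R + 1 then
      if ∀ r ∈ Icc 1 R, ∀ i ∈ cols r, m' r i = m r i then
        (if Even (R + 1) then sgn (thetaSum m ((R + 1) / 2)) else 1) * iso0 m m' (R + 1)
      else 0
    else iso1 m m' (R + 1) * cgc m m' j R

/-! ### Reduced matrix elements -/

/-- `1` on even integers, `0` on odd ones. -/
def evenInd (x : ℤ) : ℝ := if Even x then 1 else 0

/-- `1` on odd integers, `0` on even ones. -/
def oddInd (x : ℤ) : ℝ := if Even x then 0 else 1

/-- The reduced matrix element `([m]_{+(k)} || c⁺ || [m])` of the Fock representation `V(p,n)`, for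
the `gl(n|n)` highest weight `[m] = w` (columns `-n, …, -1, 1, …, n`). -/
def reduced (n p : ℕ) (w : ℤ → ℕ) (k : ℤ) : ℝ :=
  let J : Finset ℤ := Icc 1 (n : ℤ)
  let A : ℤ → ℝ := fun j => w (j - n - 1)
  let B : ℤ → ℝ := fun j => w j
  let pos : ℤ := n + k + 1
  if k < 0 then
    if Even pos then
      Real.sqrt (-quot
        (factors {pos} (fun _ => evenInd n * (A pos - pos) + 1) +
          factors (J.erase pos) (fun j => A pos - A j - pos + j) +
          factors J (fun j => A pos + B j + n - j - pos + 2))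
        (factors {j ∈ J.erase pos | Even j} (fun j => A pos - A j - pos + j) +
          factors {j ∈ J.erase pos | Even j} (fun j => A pos - A j - pos + j + 1) +
          factors J (fun j => A pos + B j + n - j - pos + 2 - evenInd (n + w j))))
    else
      Real.sqrt (quot
        (factors {pos} (fun _ => p - A pos + pos - 1) +
          factors {pos} (fun _ => oddInd n * (A pos - pos) + 1) +
          factors (J.erase pos) (fun j => A pos - A j - pos + j) +
          factors J (fun j => A pos + B j + n - j - pos + 2))
        (factors {j ∈ J.erase pos | ¬ Even j} (fun j => A pos - A j - pos + j) +
          factors {j ∈ J.erase pos | ¬ Even j} (fun j => A pos - A j - pos + j + 1) +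
          factors J (fun j => A pos + B j + n - j - pos + 2 - oddInd (n + w j))))
  else
    sgn (∑ j ∈ Icc (k + 1) (n : ℤ), (w j : ℤ)) *
      Real.sqrt (quot
        (factors {k} (fun _ => oddInd (w k) * (B k + n - k) + 1) +
          factors {k} (fun _ => evenInd (n + w k) * (p + B k + n - k) + 1) +
          factors (J.erase k) (fun j => B j - B k - j + k) +
          factors {j ∈ J | Even (n + w k + j)} (fun j => A j + B k + n - j - k + 2))
        (factors (J.erase k) (fun j => B j - B k - j + k - oddInd ((w j : ℤ) - w k)) +
          factors {j ∈ J | ¬ Even (n + w k + j)} (fun j => A j + B k + n - j - k + 1)))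

/-! ### The action of the creation and annihilation operators -/

/-- The row function: `ρ(i) = 2i` for `i > 0` and `ρ(i) = -2i-1` for `i < 0`. -/
def rho (i : ℤ) : ℕ := if 0 < i then (2 * i).toNat else (-2 * i - 1).toNat

/-- The matrix elements `C⁺[i, |m)^{2n}, |m')^{2n}]` of `c_i⁺` in `V(p,n)`. -/
def coeffPlus {n p : ℕ} (i : ℤ) (m m' : GZPattern n p) : ℝ :=
  ∑ k ∈ cols (2 * n), if Raised m.entry m'.entry (2 * n) k then
    cgc m.entry m'.entry (rho i) (2 * n) * reduced n p (m.entry (2 * n)) k else 0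

/-- The matrix elements `C^ξ[i, |m)^{2n}, |m')^{2n}]` of `c_i^ξ` in `V(p,n)`, for a sign `ξ = ±1`.
Those of `c_i⁻` are obtained from `(c_i⁺)† = c_i⁻`. -/
def coeff {n p : ℕ} (ξ : ℤˣ) (i : ℤ) (m m' : GZPattern n p) : ℝ :=
  if ξ = 1 then coeffPlus i m m' else coeffPlus i m' m

theorem coeffPlus_bound {n p : ℕ} {i : ℤ} {m m' : GZPattern n p} (h : coeffPlus i m m' ≠ 0)
    (r : ℕ) (c : ℤ) : m.entry r c ≤ m'.entry r c ∧ m'.entry r c ≤ m.entry r c + 1 := by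
  have key : ∀ R : ℕ, cgc m.entry m'.entry (rho i) R ≠ 0 → ∀ r : ℕ, 1 ≤ r → r ≤ R →
      ∀ c ∈ cols r, m.entry r c ≤ m'.entry r c ∧ m'.entry r c ≤ m.entry r c + 1 := by
    intro R
    induction R with
    | zero => intro h; exact absurd rfl h
    | succ R ih =>
      intro h r h1 h2 c hc
      rw [cgc] at h
      split_ifs at h with hj hlow hev
      · rcases Nat.lt_or_ge R r with hr | hr
        · obtain rfl : r = R + 1 := by omega
          have h0 : iso0 m.entry m'.entry (R + 1) ≠ 0 := right_ne_zero_of_mul h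
          obtain ⟨k, -, hk⟩ := Finset.exists_ne_zero_of_sum_ne_zero h0
          have := (ite_ne_right_iff.1 hk).1 c hc
          split_ifs at this <;> omega
        · have := hlow r (by simp; omega) c hc
          omega
      · rcases Nat.lt_or_ge R r with hr | hr
        · obtain rfl : r = R + 1 := by omega
          have h0 : iso0 m.entry m'.entry (R + 1) ≠ 0 := right_ne_zero_of_mul h
          obtain ⟨k, -, hk⟩ := Finset.exists_ne_zero_of_sum_ne_zero h0
          have := (ite_ne_right_iff.1 hk).1 c hc
          split_ifs at this <;> omega
        · have := hlow r (by simp; omega) c hc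
          omega
      · exact absurd rfl h
      · rcases Nat.lt_or_ge R r with hr | hr
        · obtain rfl : r = R + 1 := by omega
          have h0 : iso1 m.entry m'.entry (R + 1) ≠ 0 := left_ne_zero_of_mul h
          obtain ⟨k, -, hk⟩ := Finset.exists_ne_zero_of_sum_ne_zero h0
          obtain ⟨q, -, hq⟩ := Finset.exists_ne_zero_of_sum_ne_zero hk
          have := (ite_ne_right_iff.1 hq).1.1 c hc
          split_ifs at this <;> omega
        · exact ih (right_ne_zero_of_mul h) r h1 hr c hc
  obtain ⟨k, -, hk⟩ := Finset.exists_ne_zero_of_sum_ne_zero h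
  have hc := left_ne_zero_of_mul (ite_ne_right_iff.1 hk).2
  by_cases hs : 1 ≤ r ∧ r ≤ 2 * n ∧ c ∈ cols r
  · exact key _ hc r hs.1 hs.2.1 c hs.2.2
  · rw [m.entry_eq_zero r c hs, m'.entry_eq_zero r c hs]
    omega

theorem finite_bounded {n p : ℕ} (b : ℕ → ℤ → ℕ) :
    {m : GZPattern n p | ∀ r c, m.entry r c ≤ b r c}.Finite := by
  let T : Finset (ℕ × ℤ) := (Icc 1 (2 * n)).sigma (fun r => cols r) |>.map
    (Equiv.sigmaEquivProd ℕ ℤ).toEmbedding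
  let f : GZPattern n p → (T → ℕ) := fun m x => m.entry x.1.1 x.1.2
  have hT : ∀ r c, (r, c) ∈ T ↔ (1 ≤ r ∧ r ≤ 2 * n ∧ c ∈ cols r) := by
    intro r c
    simp [T, and_assoc]
  have hf : Function.Injective f := by
    intro m m' h
    ext r c
    by_cases hs : 1 ≤ r ∧ r ≤ 2 * n ∧ c ∈ cols r
    · exact congrFun h ⟨(r, c), (hT r c).2 hs⟩
    · rw [m.entry_eq_zero r c hs, m'.entry_eq_zero r c hs]
  refine Set.Finite.subset (Set.Finite.preimage hf.injOn
    (Set.Finite.pi' (t := fun x : T => Set.Iic (b x.1.1 x.1.2)) fun x => Set.finite_Iic _)) ?_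
  intro m hm x
  exact hm _ _

theorem coeff_finite {n p : ℕ} (ξ : ℤˣ) (i : ℤ) (m : GZPattern n p) :
    (Function.support fun m' => (coeff ξ i m m' : ℂ)).Finite := by
  refine (finite_bounded (n := n) (p := p) fun r c => m.entry r c + 1).subset ?_
  intro m' hm' r c
  have hm : coeff ξ i m m' ≠ 0 := by simpa using hm'
  rw [coeff] at hm
  split_ifs at hm
  · exact (coeffPlus_bound hm r c).2
  · exact (coeffPlus_bound hm r c).1.trans (Nat.le_succ _)

/-- The space with basis the patterns `|m)^{2n}`: the (algebraic) Fock space `V(p,n)`. -/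
abbrev Fock (n p : ℕ) : Type := GZPattern n p →₀ ℂ

/-- The basis vector `|m)^{2n}`. -/
def ket {n p : ℕ} (m : GZPattern n p) : Fock n p := Finsupp.single m 1

/-- The operator `c_i^ξ` on `V(p,n)`, for `i ∈ [-n,n]*`:
`c_i^ξ |m) = ∑_{m'} C^ξ[i, |m), |m')] |m')`. -/
def opC (n p : ℕ) (ξ : ℤˣ) (i : ℤ) : Fock n p →ₗ[ℂ] Fock n p :=
  Finsupp.linearCombination ℂ fun m =>
    Finsupp.ofSupportFinite (fun m' => (coeff ξ i m m' : ℂ)) (coeff_finite ξ i m)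

/-! ### The map `φ_{2n,+2}` -/

/-- The labels of `φ_{2n,+2}(|m)^{2n})`. If the top row of `|m)^{2n}` is `[ν₁, …, νₙ; 0, …, 0]`, the
two new rows `2n+1` and `2n+2` are `[ν₁, …, νₙ, 0; 0, …, 0]`. -/
def extendEntry {n p : ℕ} (m : GZPattern n p) (r : ℕ) (i : ℤ) : ℕ :=
  if r ≤ 2 * n then m.entry r i
  else if r ≤ 2 * n + 2 ∧ i ≤ -2 then m.entry (2 * n) (i + 1)
  else 0

theorem mem_rightCols {s : ℕ} {i : ℤ} : i ∈ rightCols (2 * s) ↔ 1 ≤ i ∧ i ≤ s := by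
  simp [rightCols]

theorem mem_cols {r : ℕ} {i : ℤ} :
    i ∈ cols r ↔ (-(((r + 1) / 2 : ℕ) : ℤ) ≤ i ∧ i ≤ -1) ∨ (1 ≤ i ∧ i ≤ ((r / 2 : ℕ) : ℤ)) := by
  simp [cols, leftCols, rightCols]

/-- The map `φ_{2n,+2}` on patterns with zero second part. -/
def GZPattern.extend {n p : ℕ} (m : GZPattern n p) (h : m.RightZero) : GZPattern (n + 1) p where
  entry := extendEntry m
  entry_eq_zero := by
    intro r i hi
    rw [mem_cols] at hi
    unfold extendEntry
    split_ifs with h1 h2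
    · apply m.entry_eq_zero
      rw [mem_cols]
      omega
    · apply m.entry_eq_zero
      rw [mem_cols]
      omega
    · rfl
  le_order := by
    unfold extendEntry
    rw [if_neg (by omega)]
    split_ifs with h2
    · have := m.le_order
      push_cast at *
      rwa [show -((n : ℤ) + 1) + 1 = -n by ring]
    · exact Nat.zero_le _
  top_left := by
    intro j h1 h2
    push_cast at h1
    unfold extendEntry
    split_ifs with h3 h4 h5
    · omega
    · exact m.top_left (j + 1) (by omega) h4.2
    · omega
    · exact Nat.zero_le _
    · exact le_rfl
  top_right := by
    intro j h1 h2
    unfold extendEntry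
    rw [if_neg (by omega), if_neg (by omega), if_neg (by omega), if_neg (by omega)]
  theta_left := by
    intro s h1 h2 i h3 h4
    rcases Nat.lt_or_ge n s with hs | hs
    · left
      unfold extendEntry
      split_ifs <;> first | rfl | omega
    · have := m.theta_left s h1 hs i h3 h4
      unfold extendEntry
      rwa [if_pos (by omega), if_pos (by omega)]
  theta_right := by
    intro s h1 h2 i h3 h4
    rcases Nat.lt_or_ge s n with hs | hs
    · have := m.theta_right s h1 hs i h3 h4
      unfold extendEntry
      rwa [if_pos (by omega), if_pos (by omega)]
    · obtain rfl : s = n := by omega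
      left
      unfold extendEntry
      rw [if_pos (by omega), if_neg (by omega), if_neg (by omega)]
      exact h i (mem_rightCols.2 ⟨h3, h4⟩)
  count_even := by
    intro s h1 h2
    rcases Nat.lt_or_ge n s with hs | hs
    · have : #{i ∈ rightCols (2 * s) | 0 < extendEntry m (2 * s) i} = 0 := by
        rw [Finset.card_eq_zero, Finset.filter_eq_empty_iff]
        intro i hi
        rw [mem_rightCols] at hi
        unfold extendEntry
        rw [if_neg (by omega), if_neg (by omega)]
        omega
      omega
    · have := m.count_even s h1 hs
      unfold extendEntry
      simpa only [if_pos (by omega : 2 * s ≤ 2 * n)] using this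
  count_odd := by
    intro s h1 h2
    rcases Nat.lt_or_ge s n with hs | hs
    · have := m.count_odd s h1 hs
      unfold extendEntry
      simpa only [if_pos (by omega : 2 * s ≤ 2 * n), if_pos (by omega : 2 * s + 1 ≤ 2 * n)]
        using this
    · obtain rfl : s = n := by omega
      have : #{i ∈ rightCols (2 * s) | 0 < extendEntry m (2 * s) i} = 0 := by
        rw [Finset.card_eq_zero, Finset.filter_eq_empty_iff]
        intro i hi
        unfold extendEntry
        rw [if_pos le_rfl, h i hi]
        omega
      omega
  between_right := by
    intro s h1 h2 i h3 h4
    rcases Nat.lt_or_ge n s with hs | hs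
    · unfold extendEntry
      rw [if_neg (by omega), if_neg (by omega), if_neg (by omega), if_neg (by omega),
        if_neg (by omega), if_neg (by omega)]
      exact ⟨le_rfl, le_rfl⟩
    · have := m.between_right s h1 hs i h3 h4
      unfold extendEntry
      rwa [if_pos (by omega), if_pos (by omega), if_pos (by omega)]
  between_left := by
    intro s h1 h2 i h3 h4
    rcases Nat.lt_or_ge s n with hs | hs
    · have := m.between_left s h1 hs i h3 h4
      unfold extendEntry
      rwa [if_pos (by omega), if_pos (by omega), if_pos (by omega)]
    · obtain rfl : s = n := by omega
      unfold extendEntry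
      constructor
      · rw [show -i - 1 + 1 = -i by ring]
        split_ifs with h5 h6 h7 <;> first | exact le_rfl | omega
      · split_ifs <;> first
          | omega
          | exact Nat.zero_le _
          | exact m.top_left (-i) (by omega) (by omega)

/-- A pattern that is row-stable with respect to its top row has zero second part. -/
theorem GZPattern.RowStable.rightZero {n p : ℕ} {m : GZPattern n p} (h : m.RowStable (2 * n)) :
    m.RightZero := by
  obtain ⟨ν, -, hν⟩ := h
  exact (hν (2 * n) le_rfl le_rfl).2.2

/-- The linear combinations of basis vectors with zero second part. -/
def rightZeroSpace (n p : ℕ) : Submodule ℂ (Fock n p) :=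
  Finsupp.supported ℂ ℂ {m : GZPattern n p | m.RightZero}

theorem ket_mem {n p : ℕ} {m : GZPattern n p} (h : m.RightZero) : ket m ∈ rightZeroSpace n p :=
  Finsupp.single_mem_supported ℂ 1 h

/-- The linear extension of `φ_{2n,+2}` to linear combinations of vectors with zero second
part. -/
def phi (n p : ℕ) : rightZeroSpace n p →ₗ[ℂ] Fock (n + 1) p :=
  (Finsupp.lmapDomain ℂ ℂ
    fun m : {m : GZPattern n p | m.RightZero} => GZPattern.extend m.1 m.2) ∘ₗ
    (Finsupp.supportedEquivFinsupp {m : GZPattern n p | m.RightZero}).toLinearMap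

end OddGZ

end

/-!
The map `φ_{2n,+2}` adds two rows that repeat the top row `[ν; 0]`, with a zero appended to its
left part. Two facts make the action of `c_i^±`, `i ∈ [-n,n]*`, commute with it.

* Matrix elements between extended patterns agree with the original ones (`coeffPlus_extend`). The
  label raised in column `q` of row `2n` is then raised in column `q - 1` of both new rows. The
  isoscalar factor of rows `2n+2`, `2n+1` is `1` because the rows agree (`isoEven1_self`), and
  that of rows `2n+1`, `2n` is `1` because its numerator and denominator have the same factors
  (`isoOdd1_shift`). The reduced matrix element does not change either (`reduced_succ`): with zero
  right part, the products over the right part telescope in the ranks of one parity, and this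
  makes up for the factors which the appended zero contributes. All these are identities of
  multisets of factors, so they hold in the presence of vanishing factors too.

* A pattern `M` that `c_i^±` reaches from an extended pattern `φ(m)` is itself an extended pattern
  (`exists_extend_of_coeff_ne_zero`). The rows `2n`, `2n+1`, `2n+2` of `M` and `φ(m)` differ in
  one label each, and the betweenness and `θ` conditions satisfied by both patterns force the
  three columns to correspond. The right part stays zero because `m_{-1,2n} = 0`: a positive label
  there would require the label in column `-1` of the new pattern to be positive as well, but only
  one label of a row is raised.

The proposition then follows by comparing coefficients on each basis vector of `V(p,n+1)`.
-/

namespace OddGZ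

/-! ### Quotients of families of factors -/

/-- Common factors of numerator and denominator cancel even when they vanish. -/
theorem quot_add_left (c num den : Multiset ℝ) : quot (c + num) (c + den) = quot num den := by
  have hc : (c.filter fun x => x ≠ 0).prod ≠ 0 :=
    Multiset.prod_ne_zero fun h => (Multiset.mem_filter.1 h).2 rfl
  simp only [quot, Multiset.count_add, add_lt_add_iff_left, Multiset.filter_add, Multiset.prod_add,
    mul_div_mul_left _ _ hc]

theorem quot_self (c : Multiset ℝ) : quot c c = 1 := by
  simp [quot]

theorem quot_one_add (num den : Multiset ℝ) : quot ({1} + num) den = quot num den := by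
  have h : Multiset.filter (fun x : ℝ => x ≠ 0) {1} = {1} :=
    Multiset.filter_eq_self.2 fun a ha => by rw [Multiset.mem_singleton.1 ha]; exact one_ne_zero
  simp only [quot, Multiset.filter_add, Multiset.prod_add, h, Multiset.prod_singleton, one_mul,
    Multiset.count_add, Multiset.count_singleton, zero_ne_one, if_false, zero_add]

theorem factors_insert {s : Finset ℤ} {i : ℤ} (h : i ∉ s) (f : ℤ → ℝ) :
    factors (insert i s) f = {f i} + factors s f := by
  simp [factors, Finset.insert_val_of_notMem h]

theorem factors_congr {s : Finset ℤ} {f g : ℤ → ℝ} (h : ∀ i ∈ s, f i = g i) :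
    factors s f = factors s g :=
  Multiset.map_congr rfl h

theorem Icc_one_succ (n : ℕ) : Icc 1 ((n + 1 : ℕ) : ℤ) = insert ((n : ℤ) + 1) (Icc 1 (n : ℤ)) := by
  ext j
  simp only [mem_Icc, mem_insert]
  omega

/-- Shifting a family of factors by one trades its first member for its last. -/
theorem factors_shift (f : ℤ → ℝ) (n : ℕ) :
    {f n} + factors (Icc 1 (n : ℤ)) (fun j => f (j - 1)) = {f 0} + factors (Icc 1 (n : ℤ)) f := by
  induction n with
  | zero => simp [factors]
  | succ n ih =>
    have hn : (n : ℤ) + 1 ∉ Icc 1 (n : ℤ) := by simp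
    rw [Icc_one_succ, factors_insert hn, factors_insert hn, add_sub_cancel_right, ih]
    push_cast
    abel

/-! ### Stability of the reduced matrix elements -/

/-- The quotient under the root of the reduced matrix element does not change when the rank grows
from `n` to `n + 1` and a zero label is appended to the left part.
The predicate `Q` is `Even` or `¬ Even`, according to the parity of the position `κ` of the raised
label; `C` collects the factors independent of the rank, `y` stands for `A_κ - κ` and `x j` for
`A_κ - A_j - κ + j`. -/
theorem quot_rank_succ (n : ℕ) (Q : ℤ → Prop) [DecidablePred Q] (hQ : Q (n + 1) ↔ ¬ Q n)
    (C : Multiset ℝ) (x : ℤ → ℝ) (y : ℝ) (pos : ℤ) (hpos : pos ≤ n) (hx : x (n + 1) = y + n + 1) :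
    quot (C + {(if Q ((n + 1 : ℕ) : ℤ) then 1 else 0) * y + 1} +
        factors ((Icc 1 ((n + 1 : ℕ) : ℤ)).erase pos) x +
        factors (Icc 1 ((n + 1 : ℕ) : ℤ)) (fun j => y + (n + 1 : ℕ) - j + 2))
      (factors {j ∈ (Icc 1 ((n + 1 : ℕ) : ℤ)).erase pos | Q j} x +
        factors {j ∈ (Icc 1 ((n + 1 : ℕ) : ℤ)).erase pos | Q j} (fun j => x j + 1) +
        factors (Icc 1 ((n + 1 : ℕ) : ℤ))
          (fun j => y + (n + 1 : ℕ) - j + 2 - if Q ((n + 1 : ℕ) : ℤ) then 1 else 0)) =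
    quot (C + {(if Q (n : ℤ) then 1 else 0) * y + 1} +
        factors ((Icc 1 (n : ℤ)).erase pos) x +
        factors (Icc 1 (n : ℤ)) (fun j => y + n - j + 2))
      (factors {j ∈ (Icc 1 (n : ℤ)).erase pos | Q j} x +
        factors {j ∈ (Icc 1 (n : ℤ)).erase pos | Q j} (fun j => x j + 1) +
        factors (Icc 1 (n : ℤ)) (fun j => y + n - j + 2 - if Q (n : ℤ) then 1 else 0)) := by
  -- In the rank `N` with `Q N` the products over the right part telescope, up to the factor `y + 1`
  -- that the parity indicator supplies.
  have tele : ∀ N : ℕ, {y + 1} + factors (Icc 1 (N : ℤ)) (fun j => y + N - j + 2) =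
      {y + N + 1} + factors (Icc 1 (N : ℤ)) (fun j => y + N - j + 2 - 1) := by
    intro N
    have := factors_shift (fun j => y + N - j + 2 - 1) N
    convert this using 3
    · push_cast; ring
    · push_cast; ring_nf
    · push_cast; ring
  have hn : (n : ℤ) + 1 ∉ (Icc 1 (n : ℤ)).erase pos := by simp
  have herase : (Icc 1 ((n + 1 : ℕ) : ℤ)).erase pos =
      insert ((n : ℤ) + 1) ((Icc 1 (n : ℤ)).erase pos) := by
    rw [Icc_one_succ, erase_insert_of_ne (by omega)]
  have hn' : (n : ℤ) + 1 ∉ {j ∈ (Icc 1 (n : ℤ)).erase pos | Q j} :=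
    fun h => hn (mem_filter.1 h).1
  have hc : ((n + 1 : ℕ) : ℤ) = (n : ℤ) + 1 := by push_cast; rfl
  have hfilter : {j ∈ insert ((n : ℤ) + 1) ((Icc 1 (n : ℤ)).erase pos) | Q j} =
      if Q (n + 1) then insert ((n : ℤ) + 1) {j ∈ (Icc 1 (n : ℤ)).erase pos | Q j}
        else {j ∈ (Icc 1 (n : ℤ)).erase pos | Q j} := filter_insert _ _ _
  rw [herase, factors_insert hn, hfilter, hc]
  have t0 := tele n
  have t1 := tele (n + 1)
  rw [hc] at t1
  set E := factors ((Icc 1 (n : ℤ)).erase pos) x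
  by_cases h : Q (n : ℤ)
  -- Rank `n` telescopes to the factor `y + n + 1`, which in rank `n + 1` is the new factor
  -- `x (n + 1)`.
  · have h1 : ¬ Q ((n : ℤ) + 1) := fun h' => hQ.1 h' h
    simp only [if_pos h, if_neg h1, zero_mul, zero_add, one_mul, sub_zero, hx]
    generalize factors {j ∈ (Icc 1 (n : ℤ)).erase pos | Q j} x = D₁
    generalize factors {j ∈ (Icc 1 (n : ℤ)).erase pos | Q j} (fun j => x j + 1) = D₂
    trans quot (C + {y + n + 1} + E) (D₁ + D₂)
    · generalize factors (Icc 1 ((n : ℤ) + 1)) (fun j => y + (n + 1 : ℕ) - j + 2) = F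
      rw [show C + {1} + ({y + n + 1} + E) + F = F + ({1} + (C + {y + n + 1} + E)) by abel,
        add_comm (D₁ + D₂) F, quot_add_left, quot_one_add]
    · generalize factors (Icc 1 (n : ℤ)) (fun j => y + n - j + 2 - 1) = F at *
      generalize factors (Icc 1 (n : ℤ)) (fun j => y + n - j + 2) = F' at *
      rw [show C + {y + 1} + E + F' = C + E + ({y + 1} + F') by abel, t0,
        show C + E + ({y + n + 1} + F) = F + (C + {y + n + 1} + E) by abel,
        add_comm (D₁ + D₂) F, quot_add_left]
  -- Rank `n + 1` telescopes to `y + n + 2`; this and `x (n + 1) = y + n + 1` cancel against the two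
  -- new factors of the denominator.
  · have h1 : Q ((n : ℤ) + 1) := hQ.2 h
    simp only [if_neg h, if_pos h1, zero_mul, zero_add, one_mul, sub_zero, hx,
      factors_insert hn']
    generalize factors {j ∈ (Icc 1 (n : ℤ)).erase pos | Q j} x = D₁
    generalize factors {j ∈ (Icc 1 (n : ℤ)).erase pos | Q j} (fun j => x j + 1) = D₂
    trans quot (C + E) (D₁ + D₂)
    · generalize factors (Icc 1 ((n : ℤ) + 1)) (fun j => y + (n + 1 : ℕ) - j + 2 - 1) = F at *
      generalize factors (Icc 1 ((n : ℤ) + 1)) (fun j => y + (n + 1 : ℕ) - j + 2) = F' at *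
      rw [show y + ((n + 1 : ℕ) : ℝ) + 1 = y + n + 1 + 1 by push_cast; ring] at t1
      generalize y + n + 1 = z at *
      rw [show C + {y + 1} + ({z} + E) + F' = C + {z} + E + ({y + 1} + F') by abel, t1,
        show C + {z} + E + ({z + 1} + F) = ({z} + {z + 1} + F) + (C + E) by abel,
        show {z} + D₁ + ({z + 1} + D₂) + F = ({z} + {z + 1} + F) + (D₁ + D₂) by abel,
        quot_add_left]
    · generalize factors (Icc 1 (n : ℤ)) (fun j => y + n - j + 2) = F
      rw [show C + {1} + E + F = F + ({1} + (C + E)) by abel,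
        add_comm (D₁ + D₂) F, quot_add_left, quot_one_add]

theorem oddInd_eq (x : ℤ) : oddInd x = if ¬ Even x then 1 else 0 := by
  simp only [oddInd, ite_not]

/-- Stability of the reduced matrix elements. Appending a zero to the left part moves column `k` to
column `k - 1` and keeps the position `n + k + 1` counted from the left. -/
theorem reduced_succ (n p : ℕ) (w w' : ℤ → ℕ) (hw : ∀ j ∈ rightCols (2 * n), w j = 0)
    (hw' : ∀ j ∈ rightCols (2 * (n + 1)), w' j = 0)
    (h : ∀ j : ℤ, -n ≤ j → j ≤ -1 → w' (j - 1) = w j) (h0 : w' (-1) = 0)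
    (k : ℤ) (hk : -n ≤ k) (hk' : k ≤ -1) :
    reduced (n + 1) p w' (k - 1) = reduced n p w k := by
  have hpos : ((n + 1 : ℕ) : ℤ) + (k - 1) + 1 = n + k + 1 := by push_cast; ring
  have hA : ∀ j ∈ Icc 1 (n : ℤ), w' (j - (n + 1 : ℕ) - 1) = w (j - n - 1) := by
    intro j hj
    rw [mem_Icc] at hj
    rw [← h _ (by omega) (by omega)]
    congr 1; push_cast; ring
  -- The quotients in `reduced`, written for either parity `Q` of the position `n + k + 1`; `C` is
  -- empty or holds the factor depending on `p`.
  have key : ∀ (Q : ℤ → Prop) [DecidablePred Q] (_ : Q (n + 1) ↔ ¬ Q n) (C : Multiset ℝ),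
    quot (C + factors {(n : ℤ) + k + 1} (fun _ => (if Q ((n + 1 : ℕ) : ℤ) then 1 else 0) *
          ((w' (n + k + 1 - (n + 1 : ℕ) - 1) : ℝ) - (n + k + 1 : ℤ)) + 1) +
        factors ((Icc 1 ((n + 1 : ℕ) : ℤ)).erase (n + k + 1))
          (fun j => (w' (n + k + 1 - (n + 1 : ℕ) - 1) : ℝ) - w' (j - (n + 1 : ℕ) - 1) -
            (n + k + 1 : ℤ) + j) +
        factors (Icc 1 ((n + 1 : ℕ) : ℤ)) (fun j => (w' (n + k + 1 - (n + 1 : ℕ) - 1) : ℝ) + w' j +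
          (n + 1 : ℕ) - j - (n + k + 1 : ℤ) + 2))
      (factors {j ∈ (Icc 1 ((n + 1 : ℕ) : ℤ)).erase (n + k + 1) | Q j}
          (fun j => (w' (n + k + 1 - (n + 1 : ℕ) - 1) : ℝ) - w' (j - (n + 1 : ℕ) - 1) -
            (n + k + 1 : ℤ) + j) +
        factors {j ∈ (Icc 1 ((n + 1 : ℕ) : ℤ)).erase (n + k + 1) | Q j}
          (fun j => (w' (n + k + 1 - (n + 1 : ℕ) - 1) : ℝ) - w' (j - (n + 1 : ℕ) - 1) -
            (n + k + 1 : ℤ) + j + 1) +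
        factors (Icc 1 ((n + 1 : ℕ) : ℤ)) (fun j => (w' (n + k + 1 - (n + 1 : ℕ) - 1) : ℝ) + w' j +
          (n + 1 : ℕ) - j - (n + k + 1 : ℤ) + 2 -
            if Q (((n + 1 : ℕ) : ℤ) + (w' j : ℤ)) then 1 else 0)) =
    quot (C + factors {(n : ℤ) + k + 1} (fun _ => (if Q (n : ℤ) then 1 else 0) *
          ((w (n + k + 1 - n - 1) : ℝ) - (n + k + 1 : ℤ)) + 1) +
        factors ((Icc 1 (n : ℤ)).erase (n + k + 1))
          (fun j => (w (n + k + 1 - n - 1) : ℝ) - w (j - n - 1) - (n + k + 1 : ℤ) + j) +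
        factors (Icc 1 (n : ℤ)) (fun j => (w (n + k + 1 - n - 1) : ℝ) + w j +
          n - j - (n + k + 1 : ℤ) + 2))
      (factors {j ∈ (Icc 1 (n : ℤ)).erase (n + k + 1) | Q j}
          (fun j => (w (n + k + 1 - n - 1) : ℝ) - w (j - n - 1) - (n + k + 1 : ℤ) + j) +
        factors {j ∈ (Icc 1 (n : ℤ)).erase (n + k + 1) | Q j}
          (fun j => (w (n + k + 1 - n - 1) : ℝ) - w (j - n - 1) - (n + k + 1 : ℤ) + j + 1) +
        factors (Icc 1 (n : ℤ)) (fun j => (w (n + k + 1 - n - 1) : ℝ) + w j +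
          n - j - (n + k + 1 : ℤ) + 2 - if Q ((n : ℤ) + (w j : ℤ)) then 1 else 0)) := by
    intro Q _ hQ C
    rw [hA _ (mem_Icc.2 ⟨by omega, by omega⟩)]
    set y : ℝ := (w (n + k + 1 - n - 1) : ℝ) - (n + k + 1 : ℤ) with hy
    have main := quot_rank_succ n Q hQ C
      (fun j => (w (n + k + 1 - n - 1) : ℝ) - w' (j - (n + 1 : ℕ) - 1) - (n + k + 1 : ℤ) + j)
      y (n + k + 1) (by omega) (by
        rw [show (n : ℤ) + 1 - (n + 1 : ℕ) - 1 = -1 by push_cast; ring, h0, hy]; push_cast; ring)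
    have hz : ∀ j ∈ Icc 1 (n : ℤ), w j = 0 := fun j hj => hw j (mem_rightCols.2 (mem_Icc.1 hj))
    have hz' : ∀ j ∈ Icc 1 ((n + 1 : ℕ) : ℤ), w' j = 0 :=
      fun j hj => hw' j (mem_rightCols.2 (mem_Icc.1 hj))
    convert main using 2
    · congr 1
      exact factors_congr fun j hj => by rw [hz' j hj, hy]; push_cast; ring
    · congr 1
      exact factors_congr fun j hj => by rw [hz' j hj, hy]; push_cast; simp only [add_zero]; ring
    · congr 1
      · congr 1
        exact factors_congr fun j hj => by rw [hA j (mem_of_mem_erase hj)]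
      · exact factors_congr fun j hj => by rw [hz j hj, hy]; push_cast; ring
    · congr 1
      · congr 1
        · exact factors_congr fun j hj => by rw [hA j (mem_of_mem_erase (mem_filter.1 hj).1)]
        · exact factors_congr fun j hj => by rw [hA j (mem_of_mem_erase (mem_filter.1 hj).1)]
      · exact factors_congr fun j hj => by rw [hz j hj, hy]; push_cast; simp only [add_zero]; ring
  unfold reduced
  simp only [if_pos (show k - 1 < 0 by omega), if_pos (show k < 0 by omega), hpos]
  split_ifs with hp
  · congr 2
    have := key Even Int.even_add_one 0
    simpa only [zero_add, evenInd] using this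
  · congr 1
    have := key (fun j => ¬ Even j) (not_congr Int.even_add_one)
      (factors {(n : ℤ) + k + 1}
        fun _ => p - (w (n + k + 1 - n - 1) : ℝ) + ((n + k + 1 : ℤ) : ℝ) - 1)
    rw [← hA (n + k + 1) (mem_Icc.2 ⟨by omega, by omega⟩)] at *
    simpa only [oddInd_eq, hA (n + k + 1) (mem_Icc.2 ⟨by omega, by omega⟩)] using this

/-! ### Isoscalar factors of the rows added on top -/

theorem isoEven1_self (t : ℤ) (u d : ℤ → ℕ) (k : ℤ) (hk : k < 0) (h : u k = d k) :
    isoEven1 t u d k k = 1 := by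
  simp [isoEven1, hk, h, sgn, ← two_mul, zpow_mul]

/-- If the raised label of the upper row has moved one column to the left and the right parts agree,
then `a_k = b_q + 1` for `k = q - 1`, and the numerator and the denominator have the same
factors. -/
theorem isoOdd1_shift (t : ℤ) (u d : ℤ → ℕ) (q : ℤ) (hq : q < 0) (h : u (q - 1) = d q)
    (hP : ∀ s ∈ Icc 1 (t - 1), u s = d s) : isoOdd1 t u d (q - 1) q = 1 := by
  have hlab : lab u (q - 1) = lab d q + 1 := by
    simp only [lab, if_pos hq, if_pos (show q - 1 < 0 by omega), h]
    push_cast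
    ring
  have hP' : ∀ s ∈ Icc 1 (t - 1), lab u s = lab d s := fun s hs => by simp only [lab, hP s hs]
  have hs : sgn (q - 1 + q) * sgnS (-(q - 1)) (-q) = 1 := by
    rw [sgnS, if_neg (by omega), sgn, Odd.neg_one_zpow ⟨q - 1, by ring⟩]
    norm_num
  simp only [isoOdd1, if_pos hq, if_pos (show q - 1 < 0 by omega), hs, hlab, one_mul]
  rw [Real.sqrt_eq_one]
  convert quot_self _ using 2
  congr 1
  · congr 1
    congr 1
    · exact factors_congr fun i _ => by ring
    · exact factors_congr fun i _ => by ring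
    · exact factors_congr fun i hi => by rw [hP' i hi]
  · exact factors_congr fun i hi => by rw [hP' i hi]

/-! ### Coefficients as single terms -/

theorem raised_unique {m m' : ℕ → ℤ → ℕ} {r : ℕ} {k l : ℤ} (hk : k ∈ cols r)
    (h : Raised m m' r k) (h' : Raised m m' r l) : l = k := by
  have h1 := h k hk
  have h2 := h' k hk
  rw [if_pos rfl] at h1
  by_contra hne
  rw [if_neg (Ne.symm hne)] at h2
  omega

theorem coeffPlus_eq {n p : ℕ} {i : ℤ} {m m' : GZPattern n p} {k : ℤ} (hk : k ∈ cols (2 * n))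
    (h : Raised m.entry m'.entry (2 * n) k) :
    coeffPlus i m m' =
      cgc m.entry m'.entry (rho i) (2 * n) * reduced n p (m.entry (2 * n)) k := by
  rw [coeffPlus, sum_eq_single_of_mem k hk, if_pos h]
  exact fun l _ hl => if_neg fun h' => hl (raised_unique hk h h')

theorem iso1_eq {m m' : ℕ → ℤ → ℕ} {r : ℕ} {k q : ℤ} (hk : k ∈ cols r) (hq : q ∈ cols (r - 1))
    (h : Raised m m' r k) (h' : Raised m m' (r - 1) q) :
    iso1 m m' r = if Even r then isoEven1 ((r / 2 : ℕ) : ℤ) (m r) (m (r - 1)) k q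
      else isoOdd1 (((r + 1) / 2 : ℕ) : ℤ) (m r) (m (r - 1)) k q := by
  rw [iso1, sum_eq_single_of_mem k hk, sum_eq_single_of_mem q hq, if_pos ⟨h, h'⟩]
  · exact fun l _ hl => if_neg fun h₂ => hl (raised_unique hq h' h₂.2)
  · exact fun l _ hl => sum_eq_zero fun _ _ => if_neg fun h₂ => hl (raised_unique hk h h₂.1)

theorem thetaSum_congr {m μ : ℕ → ℤ → ℕ} {t : ℕ} (h : ∀ r ≤ 2 * t, m r = μ r) :
    thetaSum m t = thetaSum μ t := by
  unfold thetaSum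
  congr 1
  · refine sum_congr rfl fun s hs => sum_congr rfl fun i _ => ?_
    rw [mem_Icc] at hs
    rw [h _ (by omega), h _ (by omega)]
  · refine sum_congr rfl fun s hs => sum_congr rfl fun i _ => ?_
    rw [mem_Icc] at hs
    rw [h _ (by omega), h _ (by omega)]

theorem cgc_congr {m m' μ μ' : ℕ → ℤ → ℕ} (j : ℕ) {R : ℕ} (h : ∀ r ≤ R, m r = μ r)
    (h' : ∀ r ≤ R, m' r = μ' r) : cgc m m' j R = cgc μ μ' j R := by
  induction R with
  | zero => rfl
  | succ R ih =>
    have hlow : (∀ r ∈ Icc 1 R, ∀ i ∈ cols r, m' r i = m r i) ↔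
        ∀ r ∈ Icc 1 R, ∀ i ∈ cols r, μ' r i = μ r i := by
      refine forall₂_congr fun r hr => ?_
      rw [mem_Icc] at hr
      rw [h r (by omega), h' r (by omega)]
    have h0 := h (R + 1) le_rfl
    have h0' := h' (R + 1) le_rfl
    have h1 := h R (by omega)
    have h1' := h' R (by omega)
    have hiso0 : iso0 m m' (R + 1) = iso0 μ μ' (R + 1) := by
      simp only [iso0, Raised, h0, h0', Nat.add_sub_cancel, h1]
    have hiso1 : iso1 m m' (R + 1) = iso1 μ μ' (R + 1) := by
      simp only [iso1, Raised, h0, h0', Nat.add_sub_cancel, h1, h1']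
    have hθ : thetaSum m ((R + 1) / 2) = thetaSum μ ((R + 1) / 2) :=
      thetaSum_congr fun r hr => h r (by omega)
    rw [cgc, cgc, hiso0, hiso1, hθ, ih (fun r hr => h r (by omega)) fun r hr => h' r (by omega)]
    simp only [hlow]

/-- A nonzero matrix element of `c_i⁺` raises one label in each row from `ρ(i)` on. -/
theorem exists_raised {n p : ℕ} {i : ℤ} {m m' : GZPattern n p} (h : coeffPlus i m m' ≠ 0) {r : ℕ}
    (h0 : 1 ≤ r) (h1 : rho i ≤ r) (h2 : r ≤ 2 * n) : ∃ k ∈ cols r, Raised m.entry m'.entry r k := by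
  have key : ∀ R : ℕ, cgc m.entry m'.entry (rho i) R ≠ 0 → r ≤ R →
      ∃ k ∈ cols r, Raised m.entry m'.entry r k := by
    intro R
    induction R with
    | zero => exact fun h => absurd rfl h
    | succ R ih =>
      intro h h4
      rw [cgc] at h
      split_ifs at h with hj hlow hev
      · obtain rfl : r = R + 1 := by omega
        obtain ⟨k, hk, hk'⟩ := exists_ne_zero_of_sum_ne_zero (right_ne_zero_of_mul h)
        exact ⟨k, hk, (ite_ne_right_iff.1 hk').1⟩
      · obtain rfl : r = R + 1 := by omega
        obtain ⟨k, hk, hk'⟩ := exists_ne_zero_of_sum_ne_zero (right_ne_zero_of_mul h)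
        exact ⟨k, hk, (ite_ne_right_iff.1 hk').1⟩
      · exact absurd rfl h
      · rcases Nat.lt_or_ge R r with hr | hr
        · obtain rfl : r = R + 1 := by omega
          obtain ⟨k, hk, hk'⟩ := exists_ne_zero_of_sum_ne_zero (left_ne_zero_of_mul h)
          obtain ⟨q, -, hq⟩ := exists_ne_zero_of_sum_ne_zero hk'
          exact ⟨k, hk, (ite_ne_right_iff.1 hq).1.1⟩
        · exact ih (right_ne_zero_of_mul h) hr
  obtain ⟨k, hk, hk'⟩ := exists_ne_zero_of_sum_ne_zero h
  exact key _ (left_ne_zero_of_mul (ite_ne_right_iff.1 hk').2) h2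

/-! ### Matrix elements between extended patterns -/

section Extend

variable {n p : ℕ} {m : GZPattern n p} (h : m.RightZero)

theorem extend_entry_of_le {r : ℕ} (hr : r ≤ 2 * n) : (m.extend h).entry r = m.entry r := by
  funext i
  exact if_pos hr

theorem extend_entry_top {r : ℕ} (h1 : 2 * n < r) (h2 : r ≤ 2 * n + 2) (i : ℤ) :
    (m.extend h).entry r i = if i ≤ -2 then m.entry (2 * n) (i + 1) else 0 := by
  change extendEntry m r i = _
  simp only [extendEntry, if_neg h1.not_ge, h2, true_and]

end Extend

theorem raised_extend {n p : ℕ} {m m' : GZPattern n p} (h : m.RightZero) (h' : m'.RightZero)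
    {k : ℤ} (hk : k ≤ -1) (hr : Raised m.entry m'.entry (2 * n) k) {r : ℕ} (h1 : 2 * n < r)
    (h2 : r ≤ 2 * n + 2) : Raised (m.extend h).entry (m'.extend h').entry r (k - 1) := by
  intro i hi
  rw [extend_entry_top h h1 h2, extend_entry_top h' h1 h2]
  rw [mem_cols] at hi
  split_ifs with h3 h4 h4
  · have := hr (i + 1) (mem_cols.2 (by omega))
    rwa [if_pos (by omega)] at this
  · have := hr (i + 1) (mem_cols.2 (by omega))
    rwa [if_neg (by omega)] at this
  · omega
  · rfl

theorem raised_of_raised_extend {n p : ℕ} {m m' : GZPattern n p} (h : m.RightZero)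
    (h' : m'.RightZero) {k : ℤ} (hk : k ∈ cols (2 * n + 2))
    (hr : Raised (m.extend h).entry (m'.extend h').entry (2 * n + 2) k) :
    k + 1 ∈ cols (2 * n) ∧ Raised m.entry m'.entry (2 * n) (k + 1) := by
  simp only [Raised, extend_entry_top h (Nat.lt_add_of_pos_right two_pos) le_rfl,
    extend_entry_top h' (Nat.lt_add_of_pos_right two_pos) le_rfl] at hr
  have hk2 : k ≤ -2 := by
    by_contra hk2
    have := hr k hk
    rw [if_neg hk2, if_neg hk2, if_pos rfl] at this
    omega
  rw [mem_cols] at hk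
  refine ⟨mem_cols.2 (by omega), fun i hi => ?_⟩
  have hi' := mem_cols.1 hi
  rcases lt_or_ge i 0 with hneg | hpos
  · have := hr (i - 1) (mem_cols.2 (by omega))
    rw [if_pos (by omega), if_pos (by omega), sub_add_cancel] at this
    rw [this]
    congr 1
    exact if_congr (by omega) rfl rfl
  · rw [h i (mem_rightCols.2 (by omega)), h' i (mem_rightCols.2 (by omega)), if_neg (by omega)]

/-- The matrix elements of `c_i⁺` between patterns with zero second part are not changed by the
extension: the two new isoscalar factors are `1`, and the reduced matrix element is stable. -/
theorem coeffPlus_extend {n p : ℕ} {m m' : GZPattern n p} (h : m.RightZero) (h' : m'.RightZero)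
    {i : ℤ} (hi : rho i ≤ 2 * n) :
    coeffPlus i (m.extend h) (m'.extend h') = coeffPlus i m m' := by
  by_cases hex : ∃ k ∈ cols (2 * n), Raised m.entry m'.entry (2 * n) k
  · obtain ⟨k, hk, hr⟩ := hex
    have hk' := mem_cols.1 hk
    have hneg : k ≤ -1 := by
      by_contra hpos
      have hmem : k ∈ rightCols (2 * n) := mem_rightCols.2 (by omega)
      have := hr k hk
      rw [h k hmem, h' k hmem, if_pos rfl] at this
      omega
    have r1 := raised_extend h h' hneg hr (r := 2 * n + 1) (by omega) (by omega)
    have r2 := raised_extend h h' hneg hr (r := 2 * n + 2) (by omega) (by omega)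
    have r0 : Raised (m.extend h).entry (m'.extend h').entry (2 * n) k := by
      simpa only [Raised, extend_entry_of_le h le_rfl, extend_entry_of_le h' le_rfl] using hr
    have c1 : k - 1 ∈ cols (2 * n + 1) := mem_cols.2 (by omega)
    have c2 : k - 1 ∈ cols (2 * n + 2) := mem_cols.2 (by omega)
    have e2 : iso1 (m.extend h).entry (m'.extend h').entry (2 * n + 2) = 1 := by
      rw [iso1_eq c2 (by simpa using c1) r2 (by simpa using r1), if_pos ⟨n + 1, by ring⟩]
      refine isoEven1_self _ _ _ _ (by omega) ?_
      rw [extend_entry_top h (by omega) (by omega), extend_entry_top h (by omega) (by omega)]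
    have e1 : iso1 (m.extend h).entry (m'.extend h').entry (2 * n + 1) = 1 := by
      rw [iso1_eq c1 (by simpa using hk) r1 (by simpa using r0),
        if_neg (Nat.not_even_iff_odd.2 ⟨n, rfl⟩)]
      refine isoOdd1_shift _ _ _ _ (by omega) ?_ fun s hs => ?_
      · rw [extend_entry_top h (by omega) (by omega), if_pos (by omega), Nat.add_sub_cancel,
          extend_entry_of_le h le_rfl, sub_add_cancel]
      · rw [mem_Icc] at hs
        rw [extend_entry_top h (by omega) (by omega), if_neg (by omega), Nat.add_sub_cancel,
          extend_entry_of_le h le_rfl, h s (mem_rightCols.2 (by omega))]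
    have hcgc : cgc (m.extend h).entry (m'.extend h').entry (rho i) (2 * n + 2) =
        cgc m.entry m'.entry (rho i) (2 * n) := by
      rw [cgc, if_neg (by omega), cgc, if_neg (by omega), e1, e2, one_mul, one_mul]
      exact cgc_congr _ (fun r hr => extend_entry_of_le h hr) fun r hr => extend_entry_of_le h' hr
    rw [coeffPlus_eq hk hr, coeffPlus_eq (n := n + 1) c2 r2]
    change cgc _ _ _ (2 * n + 2) * reduced (n + 1) p ((m.extend h).entry (2 * n + 2)) (k - 1) = _
    rw [hcgc, reduced_succ n p (m.entry (2 * n)) _ h _ _ _ k (by omega) hneg]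
    · intro j hj
      rw [mem_rightCols] at hj
      rw [extend_entry_top h (by omega) le_rfl, if_neg (by omega)]
    · intro j _ hj
      rw [extend_entry_top h (by omega) le_rfl, if_pos (by omega), sub_add_cancel]
    · rw [extend_entry_top h (by omega) le_rfl, if_neg (by omega)]
  · rw [coeffPlus, coeffPlus, sum_eq_zero, sum_eq_zero]
    · exact fun k hk => if_neg fun hr => hex ⟨k, hk, hr⟩
    · exact fun k hk => if_neg fun hr => hex ⟨k + 1, raised_of_raised_extend h h' hk hr⟩

theorem coeff_extend {n p : ℕ} {m m' : GZPattern n p} (h : m.RightZero) (h' : m'.RightZero)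
    {i : ℤ} (hi : rho i ≤ 2 * n) (ξ : ℤˣ) :
    coeff ξ i (m.extend h) (m'.extend h') = coeff ξ i m m' := by
  rw [coeff, coeff, coeffPlus_extend h h' hi, coeffPlus_extend h' h hi]

/-! ### Patterns reached from an extended pattern -/

/-- A pattern whose rows `2n + 1` and `2n + 2` repeat row `2n` with a zero appended, in the way of
`φ_{2n,+2}`, is an extension; the pattern it extends is its restriction to the rows up to `2n`. -/
theorem exists_extend_eq {n p : ℕ} (M : GZPattern (n + 1) p)
    (hz : ∀ i ∈ rightCols (2 * n), M.entry (2 * n) i = 0)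
    (hM : ∀ r, 2 * n < r → r ≤ 2 * n + 2 → ∀ i ∈ cols r,
      M.entry r i = if i ≤ -2 then M.entry (2 * n) (i + 1) else 0) :
    ∃ (m : GZPattern n p) (h : m.RightZero), M = m.extend h := by
  have hrow : ∀ r, r ≤ 2 * n → (fun i => if r ≤ 2 * n then M.entry r i else 0) = M.entry r :=
    fun r hr => by simp only [if_pos hr]
  let m : GZPattern n p :=
    { entry := fun r i => if r ≤ 2 * n then M.entry r i else 0
      entry_eq_zero := by
        intro r i hi
        split_ifs with hr
        · exact M.entry_eq_zero r i fun h => hi ⟨h.1, hr, h.2.2⟩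
        · rfl
      le_order := by
        rw [if_pos le_rfl]
        rcases Nat.eq_zero_or_pos n with rfl | hn
        · rw [M.entry_eq_zero _ _ (by omega)]
          exact Nat.zero_le _
        · have h1 := M.le_order
          have h2 := hM (2 * n + 2) (by omega) le_rfl (-(n : ℤ) - 1) (mem_cols.2 (by omega))
          rw [if_pos (by omega), sub_add_cancel] at h2
          rw [← h2]
          rwa [show -((n + 1 : ℕ) : ℤ) = -(n : ℤ) - 1 by push_cast; ring] at h1
      top_left := by
        intro j h1 h2
        simp only [if_pos (le_refl (2 * n))]
        have h3 := M.top_left (j - 1) (by push_cast; omega) (by omega)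
        have h4 := hM (2 * n + 2) (by omega) le_rfl (j - 1) (mem_cols.2 (by omega))
        have h5 := hM (2 * n + 2) (by omega) le_rfl j (mem_cols.2 (by omega))
        rw [if_pos (by omega), sub_add_cancel] at h4
        rw [if_pos (by omega)] at h5
        rw [sub_add_cancel] at h3
        rw [← h4, ← h5]
        exact h3
      top_right := by
        intro j h1 h2
        simp only [if_pos (le_refl (2 * n))]
        rw [hz _ (mem_rightCols.2 (by omega))]
        exact Nat.zero_le _
      theta_left := by
        intro s h1 h2
        simp only [if_pos (show 2 * s ≤ 2 * n by omega), if_pos (show 2 * s - 1 ≤ 2 * n by omega)]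
        exact M.theta_left s h1 (by omega)
      theta_right := by
        intro s h1 h2
        simp only [if_pos (show 2 * s ≤ 2 * n by omega), if_pos (show 2 * s + 1 ≤ 2 * n by omega)]
        exact M.theta_right s h1 (by omega)
      count_even := by
        intro s h1 h2
        simp only [if_pos (show 2 * s ≤ 2 * n by omega)]
        exact M.count_even s h1 (by omega)
      count_odd := by
        intro s h1 h2
        simp only [if_pos (show 2 * s ≤ 2 * n by omega), if_pos (show 2 * s + 1 ≤ 2 * n by omega)]
        exact M.count_odd s h1 (by omega)
      between_right := by
        intro s h1 h2
        simp only [if_pos (show 2 * s ≤ 2 * n by omega), if_pos (show 2 * s - 1 ≤ 2 * n by omega)]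
        exact M.between_right s h1 (by omega)
      between_left := by
        intro s h1 h2
        simp only [if_pos (show 2 * s ≤ 2 * n by omega), if_pos (show 2 * s + 1 ≤ 2 * n by omega)]
        exact M.between_left s h1 (by omega) }
  have hm : ∀ r, r ≤ 2 * n → m.entry r = M.entry r := hrow
  have h : m.RightZero := fun i hi => by rw [hm _ le_rfl, hz i hi]
  refine ⟨m, h, ?_⟩
  ext r i
  rcases Nat.lt_or_ge (2 * n) r with hr | hr
  · by_cases hs : 1 ≤ r ∧ r ≤ 2 * (n + 1) ∧ i ∈ cols r
    · rw [extend_entry_top h hr (by omega), hm _ le_rfl, hM r hr (by omega) i hs.2.2]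
    · rw [M.entry_eq_zero _ _ hs, (m.extend h).entry_eq_zero _ _ hs]
  · rw [extend_entry_of_le h hr, hm r hr]

theorem one_le_of_right_pos {n p : ℕ} (m : GZPattern n p) {s : ℕ} (h1 : 1 ≤ s) (h2 : s ≤ n)
    {k : ℤ} (hk : k ∈ rightCols (2 * s)) (h : 0 < m.entry (2 * s) k) : 1 ≤ m.entry (2 * s) (-1) :=
  le_trans (card_pos.2 ⟨k, mem_filter.2 ⟨hk, h⟩⟩) (m.count_even s h1 h2)

theorem rightZero_of_coeff_ne_zero {n p : ℕ} (hn : 1 ≤ n) {m m' : GZPattern n p}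
    (h : m.RightZero) (h0 : m.entry (2 * n) (-1) = 0) {i : ℤ} (hi : rho i ≤ 2 * n) {ξ : ℤˣ}
    (hc : coeff ξ i m m' ≠ 0) : m'.RightZero := by
  intro j hj
  have hj' := mem_rightCols.1 hj
  rw [coeff] at hc
  split_ifs at hc
  · obtain ⟨k, hk, hr⟩ := exists_raised hc (by omega) hi le_rfl
    by_contra hne
    have h1 := one_le_of_right_pos m' hn le_rfl hj (by omega)
    have h2 := hr (-1) (mem_cols.2 (by omega))
    have h3 := hr j (mem_cols.2 (by omega))
    rw [h j hj] at h3
    split_ifs at h2 h3 <;> omega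
  · have := (coeffPlus_bound hc (2 * n) j).1
    rw [h j hj] at this
    omega

/-- The pattern conditions force the labels raised in rows `2n`, `2n + 1`, `2n + 2` to be in
corresponding columns, so no vanishing of isoscalar factors is needed. The hypothesis `h0` keeps the
right part at zero: by `count_even` a positive label there would need `M_{-1,2n} ≥ 1`,
hence a second raised label. -/
theorem exists_extend_of_coeffPlus_ne_zero {n p : ℕ} (hn : 1 ≤ n) {m : GZPattern n p}
    (h : m.RightZero) (h0 : m.entry (2 * n) (-1) = 0) {M : GZPattern (n + 1) p}
    {i : ℤ} (hi : rho i ≤ 2 * n) (hc : coeffPlus i (m.extend h) M ≠ 0) :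
    ∃ (m' : GZPattern n p) (h' : m'.RightZero), M = m'.extend h' := by
  obtain ⟨q, hq, rq⟩ := exists_raised hc (by omega) hi (by omega)
  obtain ⟨k, hk, rk⟩ := exists_raised hc (r := 2 * n + 1) (by omega) (by omega) (by omega)
  obtain ⟨l, hl, rl⟩ := exists_raised hc (r := 2 * n + 2) (by omega) (by omega) (by omega)
  simp only [Raised, extend_entry_top h (show 2 * n < 2 * n + 1 by omega) (by omega)] at rk
  simp only [Raised, extend_entry_top h (show 2 * n < 2 * n + 2 by omega) le_rfl] at rl
  rw [Raised, extend_entry_of_le h le_rfl] at rq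
  rw [mem_cols] at hq hk hl
  have hz : ∀ j ∈ rightCols (2 * n), M.entry (2 * n) j = 0 := by
    intro j hj
    by_contra hne
    have h1 := one_le_of_right_pos M hn (by omega) hj (by omega)
    rw [mem_rightCols] at hj
    have h2 := rq (-1) (mem_cols.2 (by omega))
    have h3 := rq j (mem_cols.2 (by omega))
    rw [h j (mem_rightCols.2 hj)] at h3
    split_ifs at h2 h3 <;> omega
  have hq1 : q ≤ -1 := by
    by_contra hpos
    have h1 := rq q (mem_cols.2 hq)
    rw [hz q (mem_rightCols.2 (by omega)), if_pos rfl] at h1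
    omega
  have hk1 : k ≤ -1 := by
    by_contra hpos
    have h1 := rk k (mem_cols.2 hk)
    have h2 := M.theta_right n hn le_rfl k (by omega) (by omega)
    rw [hz k (mem_rightCols.2 (by omega))] at h2
    rw [if_pos rfl] at h1
    omega
  -- The label raised in column `q` of row `2n` bounds that in column `q - 1` of row `2n + 1`.
  have hkq : k = q - 1 := by
    have h1 := (M.between_left n hn le_rfl (-q) (by omega) (by omega)).1
    have h2 := rk (q - 1) (mem_cols.2 (by omega))
    have h3 := rq q (mem_cols.2 hq)
    rw [if_pos rfl] at h3
    rw [if_pos (by omega), sub_add_cancel] at h2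
    rw [neg_neg] at h1
    split_ifs at h2 <;> omega
  have hlk : l = k := by
    have h1 := M.theta_left (n + 1) (by omega) le_rfl (-k) (by omega) (by push_cast; omega)
    rw [neg_neg, show 2 * (n + 1) - 1 = 2 * n + 1 by omega,
      show 2 * (n + 1) = 2 * n + 2 by ring] at h1
    have h2 := rk k (mem_cols.2 hk)
    have h3 := rl k (mem_cols.2 (by omega))
    rw [if_pos rfl] at h2
    split_ifs at h2 h3 <;> omega
  subst hlk
  have htop : ∀ r, 2 * n < r → r ≤ 2 * n + 2 → ∀ j ∈ cols r,
      M.entry r j = (if j ≤ -2 then m.entry (2 * n) (j + 1) else 0) + if j = l then 1 else 0 := by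
    intro r h1 h2
    obtain rfl | rfl : r = 2 * n + 1 ∨ r = 2 * n + 2 := by omega
    · exact rk
    · exact rl
  refine exists_extend_eq M hz fun r h1 h2 j hj => ?_
  rw [htop r h1 h2 j hj]
  rw [mem_cols] at hj
  split_ifs with h3 h4 h4
  · rw [rq (j + 1) (mem_cols.2 (by omega)), if_pos (by omega)]
  · rw [rq (j + 1) (mem_cols.2 (by omega)), if_neg (by omega)]
  · omega
  · rfl

/-- The analogue for `c_i⁻`, which lowers labels: `M` is a pattern from which `c_i⁺` leads to the
extended pattern. -/
theorem exists_extend_of_coeffPlus_to_ne_zero {n p : ℕ} (hn : 1 ≤ n) {m : GZPattern n p}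
    (h : m.RightZero) {M : GZPattern (n + 1) p}
    {i : ℤ} (hi : rho i ≤ 2 * n) (hc : coeffPlus i M (m.extend h) ≠ 0) :
    ∃ (m' : GZPattern n p) (h' : m'.RightZero), M = m'.extend h' := by
  obtain ⟨q, hq, rq⟩ := exists_raised hc (by omega) hi (by omega)
  obtain ⟨k, hk, rk⟩ := exists_raised hc (r := 2 * n + 1) (by omega) (by omega) (by omega)
  obtain ⟨l, hl, rl⟩ := exists_raised hc (r := 2 * n + 2) (by omega) (by omega) (by omega)
  simp only [Raised, extend_entry_top h (show 2 * n < 2 * n + 1 by omega) (by omega)] at rk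
  simp only [Raised, extend_entry_top h (show 2 * n < 2 * n + 2 by omega) le_rfl] at rl
  rw [Raised, extend_entry_of_le h le_rfl] at rq
  rw [mem_cols] at hk hl
  have hz : ∀ j ∈ rightCols (2 * n), M.entry (2 * n) j = 0 := by
    intro j hj
    have h1 := h j hj
    rw [mem_rightCols] at hj
    have h2 := rq j (mem_cols.2 (by omega))
    omega
  have hk2 : k ≤ -2 := by
    by_contra hlt
    have h1 := rk k (mem_cols.2 hk)
    rw [if_neg hlt, if_pos rfl] at h1
    omega
  have hl2 : l ≤ -2 := by
    by_contra hlt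
    have h1 := rl l (mem_cols.2 hl)
    rw [if_neg hlt, if_pos rfl] at h1
    omega
  -- The label lowered in column `k` of row `2n + 1` bounds that in column `k + 1` of row `2n`.
  have hkq : q = k + 1 := by
    have h1 := (M.between_left n hn le_rfl (-k - 1) (by omega) (by omega)).1
    have h2 := rk k (mem_cols.2 hk)
    have h3 := rq (k + 1) (mem_cols.2 (by omega))
    rw [if_pos rfl, if_pos hk2] at h2
    rw [show -(-k - 1) = k + 1 by ring, add_sub_cancel_right] at h1
    split_ifs at h3 <;> omega
  have hlk : l = k := by
    have h1 := M.theta_left (n + 1) (by omega) le_rfl (-l) (by omega) (by push_cast; omega)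
    rw [neg_neg, show 2 * (n + 1) - 1 = 2 * n + 1 by omega,
      show 2 * (n + 1) = 2 * n + 2 by ring] at h1
    have h2 := rl l (mem_cols.2 hl)
    have h3 := rk l (mem_cols.2 (by omega))
    rw [if_pos rfl] at h2
    split_ifs at h2 h3 <;> omega
  subst hlk
  have htop : ∀ r, 2 * n < r → r ≤ 2 * n + 2 → ∀ j ∈ cols r,
      (if j ≤ -2 then m.entry (2 * n) (j + 1) else 0) =
        M.entry r j + if j = l then 1 else 0 := by
    intro r h1 h2
    obtain rfl | rfl : r = 2 * n + 1 ∨ r = 2 * n + 2 := by omega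
    · exact rk
    · exact rl
  refine exists_extend_eq M hz fun r h1 h2 j hj => ?_
  have h3 := htop r h1 h2 j hj
  rw [mem_cols] at hj
  split_ifs at h3 ⊢ with h4 h5 h5
  · have h6 := rq (j + 1) (mem_cols.2 (by omega))
    rw [if_pos (by omega)] at h6
    omega
  · have h6 := rq (j + 1) (mem_cols.2 (by omega))
    rw [if_neg (by omega)] at h6
    omega
  all_goals omega

theorem exists_extend_of_coeff_ne_zero {n p : ℕ} (hn : 1 ≤ n) {m : GZPattern n p}
    (h : m.RightZero) (h0 : m.entry (2 * n) (-1) = 0) {M : GZPattern (n + 1) p}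
    {i : ℤ} (hi : rho i ≤ 2 * n) {ξ : ℤˣ} (hc : coeff ξ i (m.extend h) M ≠ 0) :
    ∃ (m' : GZPattern n p) (h' : m'.RightZero), M = m'.extend h' := by
  rw [coeff] at hc
  split_ifs at hc
  · exact exists_extend_of_coeffPlus_ne_zero hn h h0 hi hc
  · exact exists_extend_of_coeffPlus_to_ne_zero hn h hi hc

/-! ### The operators and the map `φ_{2n,+2}` -/

theorem extend_injective (n p : ℕ) : Function.Injective
    fun m : {m : GZPattern n p | m.RightZero} => GZPattern.extend m.1 m.2 := by
  intro m m' heq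
  have heq' : m.1.extend m.2 = m'.1.extend m'.2 := heq
  ext r i
  rcases Nat.lt_or_ge (2 * n) r with hr | hr
  · rw [m.1.entry_eq_zero _ _ (by omega), m'.1.entry_eq_zero _ _ (by omega)]
  · rw [← extend_entry_of_le m.2 hr, ← extend_entry_of_le m'.2 hr, heq']

theorem phi_apply_extend {n p : ℕ} (v : rightZeroSpace n p) {m : GZPattern n p}
    (h : m.RightZero) : phi n p v (m.extend h) = v.1 m :=
  Finsupp.mapDomain_apply (extend_injective n p)
    (Finsupp.supportedEquivFinsupp {m : GZPattern n p | m.RightZero} v) ⟨m, h⟩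

theorem phi_apply_of_ne {n p : ℕ} (v : rightZeroSpace n p) {M : GZPattern (n + 1) p}
    (hM : ∀ (m : GZPattern n p) (h : m.RightZero), M ≠ m.extend h) : phi n p v M = 0 :=
  Finsupp.mapDomain_of_notMem_range _ _ fun ⟨m, hm⟩ => hM m.1 m.2 hm.symm

theorem phi_ket {n p : ℕ} {m : GZPattern n p} (h : m.RightZero) :
    phi n p ⟨ket m, ket_mem h⟩ = ket (m.extend h) := by
  classical
  ext M
  by_cases hM : ∃ (m' : GZPattern n p) (h' : m'.RightZero), M = m'.extend h'
  · obtain ⟨m', h', rfl⟩ := hM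
    rw [phi_apply_extend]
    simp only [ket, Finsupp.single_apply]
    refine if_congr ⟨fun e => by subst e; rfl, fun e => ?_⟩ rfl rfl
    exact congrArg Subtype.val (@extend_injective n p ⟨m, h⟩ ⟨m', h'⟩ e)
  · push Not at hM
    rw [phi_apply_of_ne _ hM]
    exact (Finsupp.single_eq_of_ne (hM m h)).symm

theorem opC_ket_apply {n p : ℕ} (ξ : ℤˣ) (i : ℤ) (m m' : GZPattern n p) :
    opC n p ξ i (ket m) m' = (coeff ξ i m m' : ℂ) := by
  simp [opC, ket, Finsupp.linearCombination_single, Finsupp.ofSupportFinite_coe]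

end OddGZ

theorem proposition10 (n p : ℕ) (hn : 1 ≤ n) (hp : 1 ≤ p) (m : OddGZ.GZPattern n p)
    (hm : m.RowStable (2 * n)) (i : ℤ) (hi0 : i ≠ 0) (hi1 : -(n : ℤ) ≤ i) (hi2 : i ≤ n)
    (ξ : ℤˣ) :
    (∃ h : OddGZ.opC n p ξ i (OddGZ.ket m) ∈ OddGZ.rightZeroSpace n p,
      OddGZ.opC (n + 1) p ξ i (OddGZ.phi n p ⟨OddGZ.ket m, OddGZ.ket_mem hm.rightZero⟩) =
        OddGZ.phi n p ⟨OddGZ.opC n p ξ i (OddGZ.ket m), h⟩) ∧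
    (∀ (m' : OddGZ.GZPattern n p) (h' : m'.RightZero),
      OddGZ.coeff ξ i (m.extend hm.rightZero) (m'.extend h') = OddGZ.coeff ξ i m m') := by
  have hi : OddGZ.rho i ≤ 2 * n := by
    unfold OddGZ.rho
    split_ifs <;> omega
  have h0 : m.entry (2 * n) (-1) = 0 := by
    obtain ⟨ν, -, hν⟩ := hm
    exact (hν (2 * n) le_rfl le_rfl).2.1
  have h := hm.rightZero
  refine ⟨⟨?_, ?_⟩, fun m' h' => OddGZ.coeff_extend h h' hi ξ⟩
  · refine (Finsupp.mem_supported ℂ _).2 fun m' hm' => ?_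
    have hne : (OddGZ.coeff ξ i m m' : ℂ) ≠ 0 := by
      rw [← OddGZ.opC_ket_apply]
      exact Finsupp.mem_support_iff.1 hm'
    exact OddGZ.rightZero_of_coeff_ne_zero hn h h0 hi (by exact_mod_cast hne)
  · ext M
    rw [OddGZ.phi_ket h, OddGZ.opC_ket_apply]
    by_cases hM : ∃ (m' : OddGZ.GZPattern n p) (h' : m'.RightZero), M = m'.extend h'
    · obtain ⟨m', h', rfl⟩ := hM
      rw [OddGZ.phi_apply_extend, OddGZ.coeff_extend h h' hi, OddGZ.opC_ket_apply]
    · rw [OddGZ.phi_apply_of_ne _ fun m' h' e => hM ⟨m', h', e⟩]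
      by_contra hne
      exact hM (OddGZ.exists_extend_of_coeff_ne_zero hn h h0 hi (by exact_mod_cast hne))
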